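/- Let $p$ be a prime and $F/\mathbb{Q}_p$ a finite extension with valuation ring $\mathcal{O}$, maximal ideal $\mathfrak{m}=(\varpi)$ (with a fixed uniformizer $\varpi$), residue field $k$ of cardinality $q=p^f$, and ramification index $e$, so that $p\mathcal{O}=\mathfrak{m}^e$. Let $[x]\in\mathcal{O}$ be the Teichmüller lift of $x\in k$. Put $\mathcal{O}_2=\mathcal{O}/\mathfrak{m}^2$ and $G_2=\mathrm{GL}_2(\mathcal{O}_2)$, let $B_2\le G_2$ be the subgroup of upper triangular matrices and $w=\begin{pmatrix}0&1\\1&0\end{pmatrix}$. For $\lambda\in\mathcal{O}_2$ let $\lambda_0,\lambda_1\in k$ be the unique elements with $\lambda=[\lambda_0]+[\lambda_1]\varpi$ in $\mathcal{O}_2$. Let $\widetilde{\mathbb{N}}$ be the quotient monoid of $(\mathbb{N}_0,+)$ by the relation: $a\sim b$ if $x^a=x^b$ for all $x\in k$. Every $\alpha\in\widetilde{\mathbb{N}}$ contains $\sum_{i=0}^{f-1}\alpha_ip^i$ for a unique tuple $(\alpha_0,\dots,\alpha_{f-1})\in\{0,\dots,p-1\}^f$; write $\alpha\preceq\beta$ if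 $\alpha_i\le\beta_i$ for all $i$. For $a\ne 0$, let $a-b$ be the unique $c\in\widetilde{\mathbb{N}}\setminus\{0\}$ with $b+c=a$; for $0\ne\alpha\preceq\beta$, let $\beta\dotdiv\alpha$ be the unique $\gamma\prec\beta$ with $\alpha+\gamma=\beta$. Let $r\in\mathbb{Z}/(q-1)\mathbb{Z}=\widetilde{\mathbb{N}}\setminus\{0\}$, let $E$ be an extension field of $k$, and let $V_{2,r}=\mathrm{Ind}_{B_2}^{G_2}\chi_r$ over $E$, where $\chi_r\begin{pmatrix}a&b\\0&d\end{pmatrix}=d_0^r$. This is the space of functions $\varphi:G_2\to E$ with $\varphi(hx)=\chi_r(h)\varphi(x)$ for $h\in B_2$, $x\in G_2$, on which $G_2$ acts by right translation; $g\otimes v$ denotes the function supported on $B_2g^{-1}$ with value $\chi_r(h)v$ at $hg^{-1}$. For $j_0,j_1\in\widetilde{\mathbb{N}}$ put $$f_{(j_0,j_1)}=\sum_{\lambda\in\mathcal{O}_2}\begin{pmatrix}\lambda&1\\1&0\end{pmatrix}\otimes\lambda_0^{j_0}\lambda_1^{j_1},\qquad f_{(\infty,j_1)}=w f_{(0,j_1)}.$$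 Let $\Theta=(\widetilde{\mathbb{N}}\cup\{\infty\})\times\widetilde{\mathbb{N}}$, and let $\le_r$ be the preorder on $\Theta$ generated by the following relations, where $j_1\in\widetilde{\mathbb{N}}$ and $0\le m\le f-1$, and where $j_0\in\widetilde{\mathbb{N}}$: 1. $(j_0\dotdiv p^m,j_1)\le_r(j_0,j_1)$ if $p^m\preceq j_0$; 2. $(j_0,j_1\dotdiv p^m)\le_r(j_0,j_1)$ if $p^m\preceq j_1$; 3. $(j_0+p^m,j_1\dotdiv p^m)\le_r(j_0,j_1)$ if $p^m\preceq j_1$; 4. $(r-2j_1-j_0,j_1)\le_r(j_0,j_1)$ if $j_0\neq 0$; 5. $(r-2j_1,j_1\dotdiv p^m)\le_r(\infty,j_1)$ if $p^m\preceq j_1$; 6. $((r-2j_1)\dotdiv p^m,j_1)\le_r(\infty,j_1)$ if $p^m\preceq r-2j_1$; 7. $(0,j_1)\le_r(\infty,j_1)$ and $(\infty,j_1)\le_r(0,j_1)$. A type is an equivalence class of $\Theta$ for the relation "$x\le_r y$ and $y\le_r x$"; write $[(j_0,j_1)]$ for the type of $(j_0,j_1)$ and $\le_r$ for the induced partial order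 on types. For a type $\theta$, let $V_\theta\subseteq V_{2,r}$ be the $E$-linear span of the vectors $f_{(j_0,j_1)}$ with $(j_0,j_1)\in\Theta$ and $[(j_0,j_1)]\le_r\theta$. **Theorem.** Suppose that $F/\mathbb{Q}_p$ is ramified, i.e. $e\ge 2$. For every type $\theta$, the subspace $V_\theta$ is a $G_2$-submodule of $V_{2,r}$. Moreover, for every $(j_0,j_1)\in\Theta$, the $G_2$-submodule of $V_{2,r}$ generated by $f_{(j_0,j_1)}$ is equal to $V_{[(j_0,j_1)]}$. -/

import Mathlib

noncomputable section

namespace GL2PS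

open IsLocalRing

/-! ### The valuation ring of a finite extension of `ℚ_p` -/

section ValuationRing

variable (p : ℕ) [Fact p.Prime] (F : Type*) [Field F] [Algebra ℚ_[p] F]
  [FiniteDimensional ℚ_[p] F]

/-- The valuation ring `𝒪` of a finite extension `F / ℚ_p`: the closed unit ball of the unique
extension to `F` of the `p`-adic absolute value. -/
def valRing : ValuationSubring F where
  carrier := {x | spectralNorm ℚ_[p] F x ≤ 1}
  mul_mem' {x y} hx hy := by
    let _ := spectralNorm.normedField ℚ_[p] F
    change ‖x * y‖ ≤ 1
    rw [norm_mul]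
    exact mul_le_one₀ hx (norm_nonneg _) hy
  one_mem' := by
    let _ := spectralNorm.normedField ℚ_[p] F
    exact (norm_one (α := F)).le
  add_mem' {x y} hx hy :=
    (isNonarchimedean_spectralNorm (K := ℚ_[p]) (L := F) x y).trans (max_le hx hy)
  zero_mem' := by
    let _ := spectralNorm.normedField ℚ_[p] F
    change ‖(0 : F)‖ ≤ 1
    simp
  neg_mem' {x} hx := by
    let _ := spectralNorm.normedField ℚ_[p] F
    change ‖-x‖ ≤ 1
    rw [norm_neg]
    exact hx
  mem_or_inv_mem' x := by
    let _ := spectralNorm.normedField ℚ_[p] F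
    change ‖x‖ ≤ 1 ∨ ‖x⁻¹‖ ≤ 1
    rw [norm_inv]
    rcases le_total ‖x‖ 1 with h | h
    · exact Or.inl h
    · exact Or.inr (inv_le_one_of_one_le₀ h)

/-- The residue field `k` of `F`. -/
abbrev ResField : Type _ := ResidueField (valRing p F)

lemma mem_maximalIdeal_iff (x : valRing p F) :
    x ∈ maximalIdeal (valRing p F) ↔ spectralNorm ℚ_[p] F (x : F) < 1 := by
  let _ := spectralNorm.normedField ℚ_[p] F
  change _ ↔ ‖(x : F)‖ < 1
  have hx : ‖(x : F)‖ ≤ 1 := x.2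
  rw [mem_maximalIdeal, mem_nonunits_iff]
  constructor
  · intro h
    refine lt_of_le_of_ne hx fun h1 => h ?_
    have hx0 : (x : F) ≠ 0 := by
      intro h0
      rw [h0, norm_zero] at h1
      exact zero_ne_one h1
    have hi : ‖(x : F)⁻¹‖ ≤ 1 := by rw [norm_inv, h1, inv_one]
    exact IsUnit.of_mul_eq_one ⟨(x : F)⁻¹, hi⟩ (Subtype.ext (mul_inv_cancel₀ hx0))
  · rintro h hu
    obtain ⟨y, hy⟩ := hu.exists_right_inv
    have hy1 : ‖(y : F)‖ ≤ 1 := y.2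
    have h2 : ‖(x : F)‖ * ‖(y : F)‖ = 1 := by
      rw [← norm_mul, ← MulMemClass.coe_mul, hy, OneMemClass.coe_one, norm_one]
    nlinarith [norm_nonneg (x : F), norm_nonneg (y : F)]

instance finite_resField : Finite (ResField p F) := by
  let _ := spectralNorm.normedField ℚ_[p] F
  let _ := spectralNorm.normedAlgebra ℚ_[p] F
  have : ProperSpace F := FiniteDimensional.proper ℚ_[p] F
  obtain ⟨t, hts, htf, ht⟩ := finite_cover_balls_of_compact
    (isCompact_closedBall (0 : F) 1) (zero_lt_one' ℝ)
  have hmem : ∀ y ∈ t, y ∈ valRing p F := fun y hy => by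
    have := hts hy
    rw [mem_closedBall_zero_iff] at this
    exact this
  have := htf.to_subtype
  refine Finite.of_surjective
    (fun y : t => residue (valRing p F) ⟨y.1, hmem y.1 y.2⟩) fun x => ?_
  obtain ⟨a, rfl⟩ := residue_surjective x
  have ha : (a : F) ∈ Metric.closedBall (0 : F) 1 := by
    rw [mem_closedBall_zero_iff]
    exact a.2
  obtain ⟨y, hy, hay⟩ := Set.mem_iUnion₂.1 (ht ha)
  refine ⟨⟨y, hy⟩, ?_⟩
  rw [Metric.mem_ball, dist_comm, dist_eq_norm] at hay
  rw [← sub_eq_zero, ← map_sub, residue_eq_zero_iff, mem_maximalIdeal_iff]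
  exact hay

lemma card_mem_maximalIdeal :
    (Nat.card (ResField p F) : valRing p F) ∈ maximalIdeal (valRing p F) := by
  have := Fintype.ofFinite (ResField p F)
  rw [← residue_eq_zero_iff, map_natCast, Nat.card_eq_fintype_card]
  exact Nat.cast_card_eq_zero _

lemma exists_teich (x : ResField p F) :
    ∃ y : valRing p F, residue _ y = x ∧ y ^ Nat.card (ResField p F) = y := by
  let _ := spectralNorm.normedField ℚ_[p] F
  let _ := spectralNorm.normedAlgebra ℚ_[p] F
  have : ProperSpace F := FiniteDimensional.proper ℚ_[p] F
  have : CompleteSpace F := inferInstance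
  have := Fintype.ofFinite (ResField p F)
  have hna : ∀ u v : F, ‖u + v‖ ≤ max ‖u‖ ‖v‖ :=
    isNonarchimedean_spectralNorm (K := ℚ_[p]) (L := F)
  have hO : ∀ u : valRing p F, ‖(u : F)‖ ≤ 1 := fun u => u.2
  obtain ⟨a, rfl⟩ := residue_surjective x
  set q := Nat.card (ResField p F) with hq
  have hq1 : ‖((q : valRing p F) : F)‖ < 1 :=
    (mem_maximalIdeal_iff p F _).1 (card_mem_maximalIdeal p F)
  have ha1 : ‖((a ^ q - a : valRing p F) : F)‖ < 1 := by
    refine (mem_maximalIdeal_iff p F _).1 ?_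
    rw [← residue_eq_zero_iff, map_sub, map_pow, hq, Nat.card_eq_fintype_card,
      FiniteField.pow_card, sub_self]
  set c := max ‖((q : valRing p F) : F)‖ ‖((a ^ q - a : valRing p F) : F)‖ with hc
  have hc1 : c < 1 := max_lt hq1 ha1
  have hc0 : 0 ≤ c := (norm_nonneg _).trans (le_max_left _ _)
  have step : ∀ u v : valRing p F, ‖((u - v : valRing p F) : F)‖ ≤ c →
      ‖((u ^ q - v ^ q : valRing p F) : F)‖ ≤ c * ‖((u - v : valRing p F) : F)‖ := by
    intro u v huv
    obtain ⟨k, hk⟩ := Polynomial.powAddExpansion v (u - v) q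
    have e : u ^ q - v ^ q = (u - v) * (q * v ^ (q - 1) + k * (u - v)) := by
      rw [add_sub_cancel] at hk
      rw [hk]; ring
    rw [e, MulMemClass.coe_mul, norm_mul, mul_comm]
    refine mul_le_mul_of_nonneg_right ?_ (norm_nonneg _)
    rw [AddMemClass.coe_add]
    refine (hna _ _).trans (max_le ?_ ?_)
    · rw [MulMemClass.coe_mul, norm_mul]
      exact (mul_le_of_le_one_right (norm_nonneg _) (hO _)).trans (le_max_left _ _)
    · rw [MulMemClass.coe_mul, norm_mul]
      exact (mul_le_of_le_one_left (norm_nonneg _) (hO _)).trans huv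
  have hdist : ∀ n : ℕ, ‖((a ^ q ^ (n + 1) - a ^ q ^ n : valRing p F) : F)‖ ≤ c * c ^ n := by
    intro n
    induction n with
    | zero =>
      rw [pow_zero c, mul_one, zero_add, pow_one, pow_zero, pow_one]
      exact le_max_right _ _
    | succ n ih =>
      have h1 : c * c ^ n ≤ c := mul_le_of_le_one_right hc0 (pow_le_one₀ hc0 hc1.le)
      have := step _ _ (ih.trans h1)
      rw [← pow_mul, ← pow_mul, ← pow_succ, ← pow_succ] at this
      refine this.trans ?_
      rw [pow_succ' c n]
      exact mul_le_mul_of_nonneg_left ih hc0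
  have hcau : CauchySeq fun n : ℕ => ((a : F) ^ q ^ n) := by
    refine cauchySeq_of_le_geometric c c hc1 fun n => ?_
    rw [dist_comm, dist_eq_norm]
    simpa using hdist n
  obtain ⟨y, hy⟩ := cauchySeq_tendsto_of_complete hcau
  have hya : ‖y - a‖ ≤ c := by
    refine le_of_tendsto (hy.sub_const (a : F)).norm (Filter.Eventually.of_forall fun n => ?_)
    induction n with
    | zero => simpa using hc0
    | succ n ih =>
      have h1 : c * c ^ n ≤ c := mul_le_of_le_one_right hc0 (pow_le_one₀ hc0 hc1.le)
      have h2 := hna ((a : F) ^ q ^ (n + 1) - a ^ q ^ n) (a ^ q ^ n - a)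
      rw [sub_add_sub_cancel] at h2
      refine h2.trans (max_le ?_ ih)
      simpa using (hdist n).trans h1
  have hyO : ‖y‖ ≤ 1 := by
    have h2 := hna (y - a) a
    rw [sub_add_cancel] at h2
    exact h2.trans (max_le (hya.trans hc1.le) (hO a))
  refine ⟨⟨y, hyO⟩, ?_, ?_⟩
  · rw [← sub_eq_zero, ← map_sub, residue_eq_zero_iff, mem_maximalIdeal_iff]
    exact hya.trans_lt hc1
  · refine Subtype.ext ?_
    have h1 := hy.pow q
    have h2 := hy.comp (Filter.tendsto_add_atTop_nat 1)
    refine tendsto_nhds_unique h1 (h2.congr fun n => ?_)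
    simp [pow_succ, pow_mul]

lemma teich_unique {y z : valRing p F} (h : residue _ y = residue _ z)
    (hy : y ^ Nat.card (ResField p F) = y) (hz : z ^ Nat.card (ResField p F) = z) : y = z := by
  have hd : y - z ∈ maximalIdeal (valRing p F) := by
    rw [← residue_eq_zero_iff, map_sub, h, sub_self]
  obtain ⟨k, hk⟩ := Polynomial.powAddExpansion z (y - z) (Nat.card (ResField p F))
  rw [add_sub_cancel, hy, hz] at hk
  set m := (Nat.card (ResField p F) : valRing p F) * z ^ (Nat.card (ResField p F) - 1)
    + k * (y - z) with hm
  have hmm : m ∈ maximalIdeal (valRing p F) :=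
    add_mem (Ideal.mul_mem_right _ _ (card_mem_maximalIdeal p F)) (Ideal.mul_mem_left _ _ hd)
  have hu : IsUnit (1 - m) := by
    by_contra hn
    have : (1 : valRing p F) ∈ maximalIdeal (valRing p F) := by
      have := add_mem ((mem_maximalIdeal _).2 hn) hmm
      rwa [sub_add_cancel] at this
    exact (Ideal.ne_top_iff_one _).1 (maximalIdeal.isMaximal _).ne_top this
  have h0 : (y - z) * (1 - m) = 0 := by
    rw [hm]; linear_combination hk
  exact sub_eq_zero.1 ((hu.mul_left_eq_zero).1 h0)

/-- The Teichmüller lift `[x] ∈ 𝒪` of `x ∈ k`: the unique lift of `x` with `[x] ^ q = [x]`. -/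
def teich (x : ResField p F) : valRing p F := (exists_teich p F x).choose

lemma residue_teich (x : ResField p F) : residue _ (teich p F x) = x :=
  (exists_teich p F x).choose_spec.1

lemma teich_pow_card (x : ResField p F) :
    teich p F x ^ Nat.card (ResField p F) = teich p F x :=
  (exists_teich p F x).choose_spec.2

/-- The ring `𝒪₂ = 𝒪 / 𝔪²`. -/
abbrev O2 : Type _ := valRing p F ⧸ (maximalIdeal (valRing p F) ^ 2)

/-- The reduction map `𝒪₂ → k`. -/
def O2.red : O2 p F →+* ResField p F :=
  Ideal.Quotient.lift _ (residue (valRing p F)) fun a ha =>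
    (residue_eq_zero_iff a).2 (Ideal.pow_le_self two_ne_zero ha)

variable {p F}

/-- The class of `[x₀] + [x₁] ϖ` in `𝒪₂`. -/
def ofDigits (ϖ : valRing p F) (x : ResField p F × ResField p F) : O2 p F :=
  Ideal.Quotient.mk _ (teich p F x.1 + teich p F x.2 * ϖ)

lemma uniformizer_ne_zero {ϖ : valRing p F}
    (hϖ : maximalIdeal (valRing p F) = Ideal.span {ϖ}) : ϖ ≠ 0 := by
  rintro rfl
  have hp : ((p : valRing p F) : F) = algebraMap ℚ_[p] F p := by simp
  have h1 : (p : valRing p F) ∈ maximalIdeal (valRing p F) := by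
    rw [mem_maximalIdeal_iff, hp, spectralNorm_extends]
    exact Padic.norm_p_lt_one
  rw [hϖ, Ideal.span_singleton_eq_bot.2 rfl, Ideal.mem_bot] at h1
  rw [h1] at hp
  have h2 : ((p : ℕ) : ℚ_[p]) = 0 := (algebraMap ℚ_[p] F).injective (by rw [← hp]; simp)
  exact (Fact.out : p.Prime).ne_zero (by exact_mod_cast h2)

lemma ofDigits_bijective {ϖ : valRing p F}
    (hϖ : maximalIdeal (valRing p F) = Ideal.span {ϖ}) : Function.Bijective (ofDigits ϖ) := by
  have hϖ0 := uniformizer_ne_zero hϖ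
  have hϖm : ϖ ∈ maximalIdeal (valRing p F) := hϖ ▸ Ideal.mem_span_singleton_self ϖ
  have hr : ∀ a b : ResField p F, residue _ (teich p F a + teich p F b * ϖ) = a := by
    intro a b
    rw [map_add, map_mul, (residue_eq_zero_iff ϖ).2 hϖm, mul_zero, add_zero, residue_teich]
  constructor
  · rintro ⟨a, b⟩ ⟨a', b'⟩ h
    have h2 := (Ideal.Quotient.mk_eq_mk_iff_sub_mem _ _).1 h
    have haa : a = a' := by
      have h3 := Ideal.pow_le_self two_ne_zero h2
      rwa [← residue_eq_zero_iff, map_sub, hr, hr, sub_eq_zero] at h3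
    subst haa
    rw [hϖ, Ideal.span_singleton_pow, Ideal.mem_span_singleton] at h2
    obtain ⟨t, ht⟩ := h2
    have h4 : teich p F b - teich p F b' = ϖ * t := by
      refine mul_right_cancel₀ hϖ0 ?_
      linear_combination ht
    have h5 : teich p F b - teich p F b' ∈ maximalIdeal (valRing p F) :=
      h4 ▸ Ideal.mul_mem_right _ _ hϖm
    rw [← residue_eq_zero_iff, map_sub, residue_teich, residue_teich, sub_eq_zero] at h5
    rw [h5]
  · intro y
    obtain ⟨z, rfl⟩ := Ideal.Quotient.mk_surjective y
    have h1 : z - teich p F (residue _ z) ∈ maximalIdeal (valRing p F) := by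
      rw [← residue_eq_zero_iff, map_sub, residue_teich, sub_self]
    rw [hϖ, Ideal.mem_span_singleton] at h1
    obtain ⟨t, ht⟩ := h1
    have h2 : t - teich p F (residue _ t) ∈ maximalIdeal (valRing p F) := by
      rw [← residue_eq_zero_iff, map_sub, residue_teich, sub_self]
    rw [hϖ, Ideal.mem_span_singleton] at h2
    obtain ⟨s, hs⟩ := h2
    refine ⟨(residue _ z, residue _ t), (Ideal.Quotient.mk_eq_mk_iff_sub_mem _ _).2 ?_⟩
    rw [hϖ, Ideal.span_singleton_pow, Ideal.mem_span_singleton]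
    exact ⟨-s, by linear_combination -ht - ϖ * hs⟩

/-- The digits `(λ₀, λ₁) ∈ k × k` of `λ ∈ 𝒪₂`, characterized by `[λ₀] + [λ₁] ϖ ∈ λ`. -/
def digits {ϖ : valRing p F}
    (hϖ : maximalIdeal (valRing p F) = Ideal.span {ϖ}) : O2 p F ≃ ResField p F × ResField p F :=
  (Equiv.ofBijective _ (ofDigits_bijective hϖ)).symm

end ValuationRing


/-! ### The monoid `Ñ` of exponents -/

section Exponents

/-- `a ∼ b` if the functions `x ↦ x ^ a` and `x ↦ x ^ b` from `k` to itself are equal. -/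
def expCon (k : Type*) [Field k] : AddCon ℕ where
  r a b := ∀ x : k, x ^ a = x ^ b
  iseqv := ⟨fun _ _ => rfl, fun h x => (h x).symm, fun h h' x => (h x).trans (h' x)⟩
  add' h h' x := by rw [pow_add, pow_add, h x, h' x]

/-- The monoid `Ñ = ℕ / ∼`. -/
abbrev Expo (k : Type*) [Field k] : Type := (expCon k).Quotient

variable {k : Type*} [Field k]

/-- The power `x ^ α` for `x ∈ k` and `α ∈ Ñ`. -/
def Expo.pow (x : k) (α : Expo k) : k := AddCon.liftOn α (fun n => x ^ n) fun _ _ h => h x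

lemma Expo.one_pow (α : Expo k) : Expo.pow 1 α = 1 := by
  induction α using AddCon.induction_on with
  | H n => exact _root_.one_pow n

lemma Expo.mul_pow (x y : k) (α : Expo k) :
    Expo.pow (x * y) α = Expo.pow x α * Expo.pow y α := by
  induction α using AddCon.induction_on with
  | H n => exact _root_.mul_pow x y n

/-- `a` is the tuple of base-`p` digits of `α`, i.e. `0 ≤ a i ≤ p - 1` and `∑ a i p ^ i ∈ α`. -/
def Expo.HasDigits (p f : ℕ) (α : Expo k) (a : Fin f → ℕ) : Prop :=
  (∀ i, a i < p) ∧ ((∑ i, a i * p ^ (i : ℕ) : ℕ) : Expo k) = α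

/-- The digitwise partial order `α ≼ β` on `Ñ`. -/
def Expo.Le (p f : ℕ) (α β : Expo k) : Prop :=
  ∃ a b : Fin f → ℕ, HasDigits p f α a ∧ HasDigits p f β b ∧ ∀ i, a i ≤ b i

/-- `a - b = c` in `Ñ`: defined for `a ≠ 0`, and then `c` is the unique non-zero element with
`b + c = a`. -/
def Expo.IsSub (a b c : Expo k) : Prop := a ≠ 0 ∧ c ≠ 0 ∧ b + c = a

/-- `β ∸ α = γ` in `Ñ`: defined for `0 ≠ α ≼ β`, and then `γ` is the unique element with
`γ ≺ β` and `α + γ = β`. -/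
def Expo.IsDotSub (p f : ℕ) (β α γ : Expo k) : Prop :=
  (α ≠ 0 ∧ Le p f α β) ∧ (Le p f γ β ∧ γ ≠ β) ∧ α + γ = β

end Exponents

/-! ### The preorder on indices, and types -/

section Types

open OnePoint

variable {k : Type*} [Field k]

/-- The index set `Θ = (Ñ ∪ {∞}) × Ñ`. The parameters `p`, `f`, `r` only serve to equip it with
the preorder `≤_r`. -/
def Theta (_p _f : ℕ) (_r : Expo k) : Type := OnePoint (Expo k) × Expo k

/-- The generating relations of `≤_r`: `Gen p f r i' i` is the relation `i' ≤_r i`. In the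
constructors, `P` is the class of `p ^ m` with `0 ≤ m ≤ f - 1`, and `s = r - 2 j₁`. -/
inductive Gen (p f : ℕ) (r : Expo k) : Theta p f r → Theta p f r → Prop
  /-- `(j₀ ∸ p ^ m, j₁) ≤ (j₀, j₁)` if `p ^ m ≼ j₀`. -/
  | lower_fst (j₀ j₁ a : Expo k) (m : ℕ) (hm : m < f)
      (ha : Expo.IsDotSub p f j₀ ((p ^ m : ℕ) : Expo k) a) :
      Gen p f r ((a : OnePoint (Expo k)), j₁) ((j₀ : OnePoint (Expo k)), j₁)
  /-- `(j₀, j₁ ∸ p ^ m) ≤ (j₀, j₁)` if `p ^ m ≼ j₁`. -/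
  | lower_snd (j₀ j₁ b : Expo k) (m : ℕ) (hm : m < f)
      (hb : Expo.IsDotSub p f j₁ ((p ^ m : ℕ) : Expo k) b) :
      Gen p f r ((j₀ : OnePoint (Expo k)), b) ((j₀ : OnePoint (Expo k)), j₁)
  /-- `(j₀ + p ^ m, j₁ ∸ p ^ m) ≤ (j₀, j₁)` if `p ^ m ≼ j₁`. -/
  | shift (j₀ j₁ b : Expo k) (m : ℕ) (hm : m < f)
      (hb : Expo.IsDotSub p f j₁ ((p ^ m : ℕ) : Expo k) b) :
      Gen p f r (((j₀ + ((p ^ m : ℕ) : Expo k) : Expo k) : OnePoint (Expo k)), b)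
        ((j₀ : OnePoint (Expo k)), j₁)
  /-- `(r - 2 j₁ - j₀, j₁) ≤ (j₀, j₁)` if `j₀ ≠ 0, ∞`. -/
  | reflect (j₀ j₁ s a : Expo k) (hj₀ : j₀ ≠ 0) (hs : Expo.IsSub r (2 • j₁) s)
      (ha : Expo.IsSub s j₀ a) :
      Gen p f r ((a : OnePoint (Expo k)), j₁) ((j₀ : OnePoint (Expo k)), j₁)
  /-- `(r - 2 j₁, j₁ ∸ p ^ m) ≤ (∞, j₁)` if `p ^ m ≼ j₁`. -/
  | infty_snd (j₁ s b : Expo k) (m : ℕ) (hm : m < f) (hs : Expo.IsSub r (2 • j₁) s)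
      (hb : Expo.IsDotSub p f j₁ ((p ^ m : ℕ) : Expo k) b) :
      Gen p f r ((s : OnePoint (Expo k)), b) (∞, j₁)
  /-- `((r - 2 j₁) ∸ p ^ m, j₁) ≤ (∞, j₁)` if `p ^ m ≼ r - 2 j₁`. -/
  | infty_fst (j₁ s a : Expo k) (m : ℕ) (hm : m < f) (hs : Expo.IsSub r (2 • j₁) s)
      (ha : Expo.IsDotSub p f s ((p ^ m : ℕ) : Expo k) a) :
      Gen p f r ((a : OnePoint (Expo k)), j₁) (∞, j₁)
  /-- `(0, j₁) ≤ (∞, j₁)`. -/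
  | zero_infty (j₁ : Expo k) : Gen p f r (((0 : Expo k) : OnePoint (Expo k)), j₁) (∞, j₁)
  /-- `(∞, j₁) ≤ (0, j₁)`. -/
  | infty_zero (j₁ : Expo k) : Gen p f r (∞, j₁) (((0 : Expo k) : OnePoint (Expo k)), j₁)

/-- The preorder `≤_r` on `Θ` generated by the relations `Gen`. -/
instance (p f : ℕ) (r : Expo k) : Preorder (Theta p f r) where
  le := Relation.ReflTransGen (Gen p f r)
  le_refl _ := Relation.ReflTransGen.refl
  le_trans _ _ _ := Relation.ReflTransGen.trans

/-- The partially ordered set of types: the equivalence classes of `Θ` for `≤_r`. -/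
abbrev Types (p f : ℕ) (r : Expo k) : Type :=
  Antisymmetrization (Theta p f r) (· ≤ ·)

/-- The type `[(j₀, j₁)]` of an index. -/
def typeOf {p f : ℕ} {r : Expo k} (i : Theta p f r) : Types p f r :=
  toAntisymmetrization (· ≤ ·) i

end Types

/-! ### Induced representations -/

section Induced

open scoped Classical in
/-- For a representation `ρ` of a subgroup `H ≤ G`, the element `g ⊗ v` of
`Ind_H^G ρ = {φ : G → V | φ (h x) = ρ (h) (φ x)}` (on which `G` acts by right translation): the
function supported on `H g⁻¹` with `(g ⊗ v) (h g⁻¹) = ρ (h) v`. -/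
def indTmul {E G V : Type*} [Field E] [Group G] [AddCommGroup V] [Module E V] {H : Subgroup G}
    (ρ : Representation E H V) (g : G) (v : V) : Representation.coindV H.subtype ρ :=
  ⟨fun x => if hx : x * g ∈ H then ρ ⟨x * g, hx⟩ v else 0, by
    intro h x
    by_cases hx : x * g ∈ H
    · have hx' : (h : G) * x * g ∈ H := by
        rw [mul_assoc]
        exact H.mul_mem h.2 hx
      have e : (⟨(h : G) * x * g, hx'⟩ : H) = h * ⟨x * g, hx⟩ := Subtype.ext (mul_assoc _ _ _)
      simp only [Subgroup.coe_subtype, dif_pos hx, dif_pos hx', e, map_mul]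
      rfl
    · have hx' : (h : G) * x * g ∉ H := by
        rw [mul_assoc]
        exact fun h' => hx ((H.mul_mem_cancel_left h.2).1 h')
      simp only [Subgroup.coe_subtype, dif_neg hx, map_zero]
      exact dif_neg hx'⟩

end Induced

/-! ### The group `GL₂(𝒪₂)` and the principal series `V_{2,r}` -/

section PrincipalSeries

open Matrix

section Matrices

variable (R : Type*) [CommRing R]

/-- The subgroup `B(R)` of upper triangular matrices in `GL₂(R)`. -/
def borel : Subgroup (GL (Fin 2) R) where
  carrier := {g | g.1 1 0 = 0}
  one_mem' := by simp
  mul_mem' {a b} ha hb := by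
    change (a.1 * b.1) 1 0 = 0
    change a.1 1 0 = 0 at ha
    change b.1 1 0 = 0 at hb
    simp [Matrix.mul_apply, Fin.sum_univ_two, ha, hb]
  inv_mem' {a} ha := by
    change a.1 1 0 = 0 at ha
    change (a⁻¹).1 1 0 = 0
    rw [Matrix.coe_units_inv, Matrix.inv_def, Matrix.adjugate_fin_two]
    simp [ha]

variable {R}

/-- The element `w = (0 1; 1 0)`. -/
def weyl : GL (Fin 2) R :=
  ⟨!![0, 1; 1, 0], !![0, 1; 1, 0], by simp [Matrix.one_fin_two], by simp [Matrix.one_fin_two]⟩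

/-- The matrix `(t 1; 1 0)`. -/
def xiMat (t : R) : GL (Fin 2) R :=
  ⟨!![t, 1; 1, 0], !![0, 1; 1, -t], by simp [Matrix.one_fin_two], by simp [Matrix.one_fin_two]⟩

end Matrices

variable {p : ℕ} [Fact p.Prime] {F : Type*} [Field F] [Algebra ℚ_[p] F]
  [FiniteDimensional ℚ_[p] F]

/-- The character `χ_r : (a b; 0 d) ↦ d₀ ^ r` of `B(𝒪₂)`, with values in `k`. -/
def chi (r : Expo (ResField p F)) : borel (O2 p F) →* ResField p F where
  toFun b := Expo.pow (O2.red p F (b.1.1 1 1)) r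
  map_one' := by simp [Expo.one_pow]
  map_mul' a b := by
    have ha : a.1.1 1 0 = 0 := a.2
    rw [← Expo.mul_pow, ← map_mul]
    simp [Matrix.mul_apply, Fin.sum_univ_two, ha]

variable (E : Type*) [Field E] [Algebra (ResField p F) E]

/-- The one-dimensional representation of `B(𝒪₂)` over `E` given by `χ_r`. -/
def chiRep (r : Expo (ResField p F)) : Representation E (borel (O2 p F)) E where
  toFun b := algebraMap (ResField p F) E (chi r b) • LinearMap.id
  map_one' := by ext; simp
  map_mul' a b := by
    ext
    simp only [map_mul, LinearMap.smul_apply, LinearMap.id_apply, Module.End.mul_apply,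
      smul_eq_mul, mul_assoc]

/-- The underlying space of `V_{2,r}`. -/
abbrev PSSpace (r : Expo (ResField p F)) : Type _ :=
  Representation.coindV (borel (O2 p F)).subtype (chiRep E r)

/-- The principal series `V_{2,r} = Ind_{B(𝒪₂)}^{GL₂(𝒪₂)} χ_r` as a representation over `E`. -/
def PS (r : Expo (ResField p F)) :
    Representation E (GL (Fin 2) (O2 p F)) (PSSpace E r) :=
  Representation.coind (borel (O2 p F)).subtype (chiRep E r)

lemma finite_O2 {ϖ : valRing p F}
    (hϖ : IsLocalRing.maximalIdeal (valRing p F) = Ideal.span {ϖ}) : Finite (O2 p F) :=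
  Finite.of_equiv _ (digits hϖ).symm

variable {ϖ : valRing p F} (hϖ : IsLocalRing.maximalIdeal (valRing p F) = Ideal.span {ϖ})

/-- `f_{(j₀, j₁)} = ∑_{λ ∈ 𝒪₂} (λ 1; 1 0) ⊗ λ₀ ^ j₀ λ₁ ^ j₁` for `j₀, j₁ ∈ Ñ`. -/
def basisFin (r j₀ j₁ : Expo (ResField p F)) : PSSpace E r :=
  letI := finite_O2 hϖ
  letI := Fintype.ofFinite (O2 p F)
  ∑ t : O2 p F, indTmul (chiRep E r) (xiMat t)
    (algebraMap (ResField p F) E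
      (Expo.pow (digits hϖ t).1 j₀ * Expo.pow (digits hϖ t).2 j₁))

/-- The vectors `f_{(j₀, j₁)}` for `(j₀, j₁) ∈ Θ`, where `f_{(∞, j₁)} = w f_{(0, j₁)}`. -/
def basisVec (f : ℕ) (r : Expo (ResField p F)) : Theta p f r → PSSpace E r
  | (OnePoint.some j₀, j₁) => basisFin E hϖ r j₀ j₁
  | (OnePoint.infty, j₁) => PS E r weyl (basisFin E hϖ r 0 j₁)

/-- `V_θ`: the span of the `f_{(j₀, j₁)}` with `[(j₀, j₁)] ≤_r θ`. -/
def typeSubspace (f : ℕ) (r : Expo (ResField p F)) (θ : Types p f r) :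
    Submodule E (PSSpace E r) :=
  Submodule.span E (basisVec E hϖ f r '' {i | typeOf i ≤ θ})

end PrincipalSeries

end GL2PS

end

/-!
In the ramified case `p = 0` in `𝒪₂`, so the Teichmüller lift is a ring homomorphism modulo `𝔪²`
(`teichHom`) and the digits `(λ₀, λ₁)` identify `𝒪₂` with `k[ϖ] / ϖ²`. An element of `V_{2,r}` is a
function of the bottom row `(c, d)` of a matrix, and `f_{(j₀, j₁)}` is the function
`λ₀ ^ j₀ λ₁ ^ j₁` of `λ = -d / c` on the big cell, where `c` is a unit (`cell`). On such functions

* an upper unipotent translates `λ`, and the translations by `-[t]` and `-[t] ϖ` suffice, which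
  expand `(λ₀ + t) ^ j₀` and `(λ₁ + t) ^ j₁`;
* a diagonal matrix scales `λ`, which up to a scalar expands `λ₀ ^ j₀ (λ₁ + t λ₀) ^ j₁`;
* `w` inverts `λ`, which sends `f_{(j₀, j₁)}` with `j₀ ≠ 0` to `± f_{(r - 2 j₁ - j₀, j₁)}`, and it
  exchanges `f_{(0, j₁)}` and `f_{(∞, j₁)}`;
* an upper unipotent changes `f_{(∞, j₁)}` by `±` what it changes `f_{(r - 2 j₁, j₁)}` by
  (`upper_weyl_basisFin`), because a non-unit `c` of `𝒪₂` satisfies `c ^ 2 = 0`.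

So the change made by a unipotent, and up to a scalar by a diagonal matrix, is a sum
`∑ t ^ i * n.choose i • v i` over `1 ≤ i ≤ n < q` (`binomSum`). By Lucas' theorem, `n.choose i` is
prime to `p` exactly if the base-`p` digits of `i` are at most those of `n`, and then `n - i` is
reached from `n` by splitting off powers of `p` one at a time (`exists_isDotSub_prime_pow`); each
such step is a generating relation of `≤_r`. So the generators of `G₂`, and hence all of `G₂`, send
`f_i` into the span of the `f_{i'}` with `i' ≤_r i` (`triangular_eq_top`). Conversely, `t` runs over
the `q` elements of `k` and the degree in `t` is less than `q`, so every `v i` with `n.choose i`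
prime to `p` lies in the submodule generated (`mem_of_forall_binomSum_mem`). Together with the
formulas for `w`, this realizes each generating relation (`basisVec_mem_of_gen`).
-/

noncomputable section

namespace GL2PS

/-! ### Exponents, base-`p` digits and binomial coefficients -/

section Combinatorics

variable {p f : ℕ}

lemma sum_digits_lt {a : Fin f → ℕ} (ha : ∀ i, a i < p) :
    ∑ i, a i * p ^ (i : ℕ) < p ^ f :=
  (finFunctionFinEquiv fun i => (⟨a i, ha i⟩ : Fin p)).2

lemma sum_digits_div_mod {a : Fin f → ℕ} (ha : ∀ i, a i < p) (j : Fin f) :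
    (∑ i, a i * p ^ (i : ℕ)) / p ^ (j : ℕ) % p = a j := by
  have h := finFunctionFinEquiv.symm_apply_apply fun i => (⟨a i, ha i⟩ : Fin p)
  exact congrArg Fin.val (congrFun h j)

lemma sum_div_mod_eq {n : ℕ} (hn : n < p ^ f) :
    ∑ i : Fin f, n / p ^ (i : ℕ) % p * p ^ (i : ℕ) = n :=
  congrArg Fin.val (finFunctionFinEquiv.apply_symm_apply (⟨n, hn⟩ : Fin (p ^ f)))

variable [Fact p.Prime]

/-- Lucas' theorem as a criterion: `n.choose i` is prime to `p` if and only if the base-`p` digits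
of `i` are at most those of `n`. -/
lemma not_dvd_choose_iff {n i : ℕ} (hn : n < p ^ f) (hi : i < p ^ f) :
    ¬ p ∣ n.choose i ↔ ∀ j : Fin f, i / p ^ (j : ℕ) % p ≤ n / p ^ (j : ℕ) % p := by
  have hp : p.Prime := Fact.out
  rw [(Choose.choose_modEq_prod_range_choose_nat hn hi).dvd_iff dvd_rfl,
    hp.prime.dvd_finsetProd_iff]
  push Not
  constructor
  · intro h j
    by_contra hlt
    refine h j (Finset.mem_range.2 j.2) ?_
    rw [Nat.choose_eq_zero_of_lt (not_le.1 hlt)]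
    exact dvd_zero p
  · intro h j hj hd
    have hle := h ⟨j, Finset.mem_range.1 hj⟩
    have hlt : n / p ^ j % p < p := Nat.mod_lt _ hp.pos
    have := (hp.dvd_factorial).1 ((hd.mul_right _).trans (dvd_of_eq
      (by rw [← mul_assoc]; exact Nat.choose_mul_factorial_mul_factorial hle)))
    omega

lemma choose_sum_digits_not_dvd {a b : Fin f → ℕ} (ha : ∀ i, a i < p) (hb : ∀ i, b i < p)
    (hab : ∀ i, a i ≤ b i) :
    ¬ p ∣ (∑ i, b i * p ^ (i : ℕ)).choose (∑ i, a i * p ^ (i : ℕ)) := by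
  rw [not_dvd_choose_iff (sum_digits_lt hb) (sum_digits_lt ha)]
  intro j
  rw [sum_digits_div_mod ha, sum_digits_div_mod hb]
  exact hab j

end Combinatorics

section ExpoLemmas

variable {k : Type*} [Field k]

lemma Expo.pow_coe (x : k) (n : ℕ) : Expo.pow x (n : Expo k) = x ^ n := rfl

lemma Expo.pow_add (x : k) (α β : Expo k) :
    Expo.pow x (α + β) = Expo.pow x α * Expo.pow x β := by
  induction α, β using AddCon.induction_on₂ with
  | H m n => exact _root_.pow_add x m n

lemma Expo.coe_eq_coe {m n : ℕ} : (m : Expo k) = n ↔ ∀ x : k, x ^ m = x ^ n := by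
  rw [AddCon.eq]
  rfl

lemma Expo.coe_add (m n : ℕ) : ((m + n : ℕ) : Expo k) = (m : Expo k) + n := rfl

lemma Expo.coe_ne_zero {n : ℕ} (hn : n ≠ 0) : (n : Expo k) ≠ 0 := by
  intro h
  have := (Expo.coe_eq_coe (m := n) (n := 0)).1 h 0
  simp [hn] at this

lemma Expo.zero_pow {α : Expo k} (hα : α ≠ 0) : Expo.pow 0 α = 0 := by
  induction α using AddCon.induction_on with
  | H n =>
    refine _root_.zero_pow ?_
    rintro rfl
    exact hα rfl

lemma Expo.pow_ne_zero {x : k} (hx : x ≠ 0) (α : Expo k) : Expo.pow x α ≠ 0 := by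
  induction α using AddCon.induction_on with
  | H n => exact _root_.pow_ne_zero n hx

lemma Expo.pow_nsmul (x : k) (α : Expo k) (n : ℕ) : Expo.pow x (n • α) = Expo.pow x α ^ n := by
  induction α using AddCon.induction_on with
  | H m => exact (pow_mul' x n m)

lemma Expo.inv_pow (x : k) (α : Expo k) : Expo.pow x⁻¹ α = (Expo.pow x α)⁻¹ := by
  induction α using AddCon.induction_on with
  | H n => exact _root_.inv_pow x n

variable [Finite k]

lemma Expo.coe_injOn {m n : ℕ} (hm : m < Nat.card k) (hn : n < Nat.card k)
    (h : (m : Expo k) = n) : m = n := by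
  have := Fintype.ofFinite k
  rw [Expo.coe_eq_coe] at h
  rw [Nat.card_eq_fintype_card] at hm hn
  have h0 : (Polynomial.X ^ m - Polynomial.X ^ n : Polynomial k) = 0 := by
    refine Polynomial.eq_zero_of_natDegree_lt_card_of_eval_eq_zero _ Function.injective_id
      (fun x => by simp [h x]) ?_
    refine (Polynomial.natDegree_sub_le _ _).trans_lt ?_
    simpa using ⟨hm, hn⟩
  by_contra hne
  have := congrArg (fun P => Polynomial.coeff P m) h0
  simp [Polynomial.coeff_X_pow, hne] at this

lemma pow_add_mul_card_sub_one {n : ℕ} (hn : n ≠ 0) (m : ℕ) (x : k) :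
    x ^ (n + m * (Nat.card k - 1)) = x ^ n := by
  have := Fintype.ofFinite k
  rcases eq_or_ne x 0 with rfl | hx
  · rw [_root_.zero_pow hn, _root_.zero_pow (by omega)]
  · rw [_root_.pow_add, mul_comm m, pow_mul, Nat.card_eq_fintype_card,
      FiniteField.pow_card_sub_one_eq_one x hx, _root_.one_pow,
      mul_one]

lemma Expo.exists_coe (α : Expo k) : ∃ n < Nat.card k, (n : Expo k) = α := by
  have hq : 1 < Nat.card k := Finite.one_lt_card
  induction α using AddCon.induction_on with
  | H n =>
    induction n using Nat.strong_induction_on with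
    | _ n ih =>
      rcases lt_or_ge n (Nat.card k) with h | h
      · exact ⟨n, h, rfl⟩
      · obtain ⟨m, hm, e⟩ := ih (n - (Nat.card k - 1)) (by omega)
        refine ⟨m, hm, e.trans (Expo.coe_eq_coe.2 fun x => ?_)⟩
        rw [← pow_add_mul_card_sub_one (by omega) 1 x, one_mul, Nat.sub_add_cancel (by omega)]

lemma Expo.exists_isSub {a : Expo k} (ha : a ≠ 0) (b : Expo k) : ∃ c, Expo.IsSub a b c := by
  have hq : 1 < Nat.card k := Finite.one_lt_card
  induction a, b using AddCon.induction_on₂ with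
  | H n m =>
    have hn : n ≠ 0 := by
      rintro rfl
      exact ha rfl
    refine ⟨((n + m * (Nat.card k - 2) : ℕ) : Expo k), ha, Expo.coe_ne_zero (by omega), ?_⟩
    rw [← Expo.coe_add, Expo.coe_eq_coe]
    intro x
    rw [← pow_add_mul_card_sub_one hn m x]
    congr 1
    obtain ⟨c, hc⟩ := Nat.exists_eq_add_of_lt hq
    rw [hc, show 1 + c + 1 - 2 = c by omega, show 1 + c + 1 - 1 = c + 1 by omega]
    ring

variable {p f : ℕ} [Fact p.Prime]

/-- The partial difference `β ∸ α` is computed on representatives less than `q`, and for these the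
binomial coefficient `n.choose i` is a unit modulo `p`. -/
lemma Expo.IsDotSub.exists_nat (hk : Nat.card k = p ^ f) {α β γ : Expo k}
    (h : Expo.IsDotSub p f β α γ) :
    ∃ n i : ℕ, n < p ^ f ∧ i ≠ 0 ∧ i ≤ n ∧ ¬ p ∣ n.choose i ∧ (n : Expo k) = β ∧ (i : Expo k) = α ∧
      ((n - i : ℕ) : Expo k) = γ := by
  obtain ⟨⟨hα, a, b, ⟨ha, rfl⟩, ⟨hb, rfl⟩, hab⟩, ⟨⟨c, b', ⟨hc, rfl⟩, ⟨hb', hbb⟩, hcb⟩, hγ⟩, hs⟩ := h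
  have hn := sum_digits_lt hb
  have hch := choose_sum_digits_not_dvd ha hb hab
  have hle : ∑ i, a i * p ^ (i : ℕ) ≤ ∑ i, b i * p ^ (i : ℕ) :=
    Finset.sum_le_sum fun i _ => Nat.mul_le_mul_right _ (hab i)
  have hcle : ∑ i, c i * p ^ (i : ℕ) ≤ ∑ i, b' i * p ^ (i : ℕ) :=
    Finset.sum_le_sum fun i _ => Nat.mul_le_mul_right _ (hcb i)
  rw [Expo.coe_injOn (hk ▸ sum_digits_lt hb') (hk ▸ hn) hbb] at hcle
  set n := ∑ i, b i * p ^ (i : ℕ)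
  set i := ∑ i, a i * p ^ (i : ℕ)
  set m := ∑ i, c i * p ^ (i : ℕ)
  have hi : i ≠ 0 := by
    intro h0
    rw [h0] at hα
    exact hα rfl
  have hm : m ≠ n := by
    intro h0
    rw [h0] at hγ
    exact hγ rfl
  refine ⟨n, i, hn, hi, hle, hch, rfl, rfl, ?_⟩
  -- `m` and `n - i` are both at most `q - 2` and agree as exponents on `kˣ`. Adding `1` makes the
  -- powers agree at `0` as well, and the exponents stay below `q`.
  have h1 : ((m + 1 : ℕ) : Expo k) = ((n - i + 1 : ℕ) : Expo k) := by
    rw [Expo.coe_eq_coe]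
    intro x
    rcases eq_or_ne x 0 with rfl | hx
    · simp
    · rw [← Expo.coe_add, Expo.coe_eq_coe] at hs
      have h2 := hs x
      rw [← Nat.add_sub_cancel' hle, _root_.pow_add, _root_.pow_add] at h2
      rw [pow_succ, pow_succ, mul_left_cancel₀ (_root_.pow_ne_zero _ hx) h2]
  have h2 := Expo.coe_injOn (by rw [hk]; omega) (by rw [hk]; omega) h1
  rw [Nat.succ_injective h2]

/-- If `i ≠ 0` and `n.choose i` is prime to `p`, then a power `p ^ m` can be split off from both. -/
lemma exists_isDotSub_prime_pow (hk : Nat.card k = p ^ f) {n i : ℕ} (hn : n < p ^ f) (hi : i ≠ 0)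
    (hin : i ≤ n) (hni : ¬ p ∣ n.choose i) :
    ∃ m < f, p ^ m ≤ i ∧
      Expo.IsDotSub p f (n : Expo k) ((p ^ m : ℕ) : Expo k) ((n - p ^ m : ℕ) : Expo k) ∧
      ¬ p ∣ (n - p ^ m).choose (i - p ^ m) := by
  have hp : p.Prime := Fact.out
  have hle := (not_dvd_choose_iff hn (hin.trans_lt hn)).1 hni
  have hi' := sum_div_mod_eq (hin.trans_lt hn)
  have hn' := sum_div_mod_eq hn
  have hap : ∀ j : Fin f, i / p ^ (j : ℕ) % p < p := fun j => Nat.mod_lt _ hp.pos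
  have hbp : ∀ j : Fin f, n / p ^ (j : ℕ) % p < p := fun j => Nat.mod_lt _ hp.pos
  set a : Fin f → ℕ := fun j => i / p ^ (j : ℕ) % p with ha
  set b : Fin f → ℕ := fun j => n / p ^ (j : ℕ) % p with hb
  obtain ⟨m, hm⟩ : ∃ m, a m ≠ 0 := by
    by_contra! h
    exact hi (hi' ▸ Finset.sum_eq_zero fun j _ => by
      rw [show i / p ^ (j : ℕ) % p = 0 from h j, zero_mul])
  set d : Fin f → ℕ := Pi.single m 1 with hd
  have hdd : ∀ j, d j ≤ a j := by
    intro j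
    rcases eq_or_ne j m with rfl | hj
    · rw [hd, Pi.single_eq_same]; omega
    · rw [hd, Pi.single_eq_of_ne hj]; exact Nat.zero_le _
  have hds : ∑ j, d j * p ^ (j : ℕ) = p ^ (m : ℕ) := by
    rw [Finset.sum_eq_single m (fun j _ hj => by rw [hd, Pi.single_eq_of_ne hj, zero_mul])
      (fun h => absurd (Finset.mem_univ _) h), hd, Pi.single_eq_same, one_mul]
  have hsub : ∀ c : Fin f → ℕ, (∀ j, d j ≤ c j) →
      ∑ j, (c j - d j) * p ^ (j : ℕ) = ∑ j, c j * p ^ (j : ℕ) - p ^ (m : ℕ) := by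
    intro c hc
    rw [← hds, eq_tsub_iff_add_eq_of_le
      (Finset.sum_le_sum fun j _ => Nat.mul_le_mul_right _ (hc j)), ← Finset.sum_add_distrib]
    exact Finset.sum_congr rfl fun j _ => by rw [← add_mul, Nat.sub_add_cancel (hc j)]
  have hdb : ∀ j, d j ≤ b j := fun j => (hdd j).trans (hle j)
  have hpi : p ^ (m : ℕ) ≤ i := by
    rw [← hi', ← hds]
    exact Finset.sum_le_sum fun j _ => Nat.mul_le_mul_right _ (hdd j)
  have hp0 : 0 < p ^ (m : ℕ) := pow_pos hp.pos _
  refine ⟨m, m.2, hpi, ⟨⟨Expo.coe_ne_zero hp0.ne', d, b, ⟨fun j => ?_, by rw [hds]⟩,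
    ⟨hbp, by rw [hn']⟩, hdb⟩, ⟨⟨fun j => b j - d j, b,
      ⟨fun j => (Nat.sub_le _ _).trans_lt (hbp j), by rw [hsub b hdb, hn']⟩, ⟨hbp, by rw [hn']⟩,
      fun j => Nat.sub_le _ _⟩, fun h => ?_⟩, ?_⟩, ?_⟩
  · exact (hdb j).trans_lt (hbp j)
  · have := Expo.coe_injOn (by rw [hk]; omega) (by rw [hk]; omega) h
    omega
  · rw [← Expo.coe_add, Nat.add_sub_cancel' (hpi.trans hin)]
  · have := choose_sum_digits_not_dvd (p := p) (a := fun j => a j - d j) (b := fun j => b j - d j)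
      (fun j => (Nat.sub_le _ _).trans_lt (hap j)) (fun j => (Nat.sub_le _ _).trans_lt (hbp j))
      (fun j => Nat.sub_le_sub_right (hle j) _)
    rwa [hsub b hdb, hsub a hdd, hn', hi'] at this

end ExpoLemmas

/-! ### Binomial families of vectors -/

section Extraction

variable {k E V : Type*} [Field k] [Field E] [Algebra k E] [AddCommGroup V] [Module E V]

/-- The vector `∑ t ^ i * n.choose i • v i`, which is the result of expanding `(y + t x) ^ n` with
`v i` in place of `x ^ i y ^ (n - i)`, without its term for `i = 0`. -/
def binomSum (n : ℕ) (v : ℕ → V) (t : k) : V :=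
  ∑ i ∈ (Finset.range (n + 1)).erase 0, algebraMap k E (t ^ i * n.choose i) • v i

lemma binomSum_mem {n : ℕ} {v : ℕ → V} {W : Submodule E V}
    (h : ∀ i, i ≠ 0 → i ≤ n → (n.choose i : k) ≠ 0 → v i ∈ W) (t : k) :
    binomSum (E := E) n v t ∈ W := by
  refine W.sum_mem fun i hi => ?_
  rw [Finset.mem_erase, Finset.mem_range] at hi
  by_cases hc : (n.choose i : k) = 0
  · simp [hc]
  · exact W.smul_mem _ (h i hi.1 (by omega) hc)

/-- A linear form vanishing on `W` turns `t ↦ binomSum n v t` into a polynomial of degree less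
than `q` with `q` zeros, so all its coefficients vanish. -/
lemma mem_of_forall_binomSum_mem [Finite k] {n : ℕ} (hn : n < Nat.card k) {v : ℕ → V}
    {W : Submodule E V} (h : ∀ t : k, binomSum (E := E) n v t ∈ W) {i : ℕ} (hi0 : i ≠ 0)
    (hi : i ≤ n) (hc : (n.choose i : k) ≠ 0) : v i ∈ W := by
  have := Fintype.ofFinite k
  by_contra hv
  obtain ⟨φ, hφ, hW⟩ := Submodule.exists_le_ker_of_notMem hv
  let P : Polynomial E := ∑ j ∈ (Finset.range (n + 1)).erase 0,
    Polynomial.monomial j (algebraMap k E (n.choose j) * φ (v j))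
  have hP : P = 0 := by
    refine Polynomial.eq_zero_of_natDegree_lt_card_of_eval_eq_zero _
      (algebraMap k E).injective (fun t => ?_) ?_
    · have h1 : φ (binomSum (E := E) n v t) = 0 := hW (h t)
      rw [binomSum, map_sum] at h1
      rw [Polynomial.eval_finsetSum, ← h1]
      refine Finset.sum_congr rfl fun j _ => ?_
      rw [Polynomial.eval_monomial, map_smul, smul_eq_mul, map_mul, map_pow]
      ring
    · refine (Polynomial.natDegree_sum_le_of_forall_le _ _ (n := n) fun j hj => ?_).trans_lt
        (Nat.card_eq_fintype_card (α := k) ▸ hn)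
      rw [Finset.mem_erase, Finset.mem_range] at hj
      exact (Polynomial.natDegree_monomial_le _).trans (by omega)
  have h2 := congrArg (fun Q => Polynomial.coeff Q i) hP
  simp only [P, Polynomial.finsetSum_coeff, Polynomial.coeff_monomial, Finset.sum_ite_eq',
    Polynomial.coeff_zero] at h2
  rw [if_pos (by simp; omega)] at h2
  rcases mul_eq_zero.1 h2 with h3 | h3
  · exact hc ((map_eq_zero _).1 h3)
  · exact hφ h3

end Extraction

/-! ### Arithmetic of `𝒪₂` in the ramified case -/

section Arithmetic

open IsLocalRing

variable {p : ℕ} [Fact p.Prime] {F : Type*} [Field F] [Algebra ℚ_[p] F]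
  [FiniteDimensional ℚ_[p] F]

lemma natCast_prime_eq_zero {e : ℕ}
    (he : Ideal.span {(p : valRing p F)} = maximalIdeal (valRing p F) ^ e) (he2 : 2 ≤ e) :
    (p : O2 p F) = 0 := by
  have h : (p : valRing p F) ∈ maximalIdeal (valRing p F) ^ 2 :=
    Ideal.pow_le_pow_right he2 (he ▸ Ideal.mem_span_singleton_self _)
  simpa using Ideal.Quotient.eq_zero_iff_mem.2 h

lemma red_mk (x : valRing p F) :
    O2.red p F (Ideal.Quotient.mk _ x) = residue (valRing p F) x := rfl

lemma mul_eq_zero_of_red {a b : O2 p F} (ha : O2.red p F a = 0) (hb : O2.red p F b = 0) :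
    a * b = 0 := by
  obtain ⟨x, rfl⟩ := Ideal.Quotient.mk_surjective a
  obtain ⟨y, rfl⟩ := Ideal.Quotient.mk_surjective b
  rw [red_mk, residue_eq_zero_iff] at ha hb
  rw [← map_mul, Ideal.Quotient.eq_zero_iff_mem, pow_two]
  exact Ideal.mul_mem_mul ha hb

lemma isUnit_iff_red_ne_zero {a : O2 p F} : IsUnit a ↔ O2.red p F a ≠ 0 := by
  refine ⟨fun h => (h.map (O2.red p F)).ne_zero, fun h => ?_⟩
  obtain ⟨x, rfl⟩ := Ideal.Quotient.mk_surjective a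
  rw [red_mk, residue_ne_zero_iff_isUnit] at h
  exact h.map _

instance nontrivial_O2 : Nontrivial (O2 p F) := (O2.red p F).domain_nontrivial

/-- If `𝒪₂` has characteristic `p`, an element of `𝒪₂` fixed by the `q`-power map is determined by
its residue: the difference of two such elements with the same residue is fixed by the `q`-power
map and has square zero. -/
lemma eq_of_pow_card_eq_self {f : ℕ} (hf : Nat.card (ResField p F) = p ^ f)
    (hp0 : (p : O2 p F) = 0) {a b : O2 p F} (ha : a ^ Nat.card (ResField p F) = a)
    (hb : b ^ Nat.card (ResField p F) = b) (h : O2.red p F a = O2.red p F b) : a = b := by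
  have hp : p.Prime := Fact.out
  have : CharP (O2 p F) p := (CharP.charP_iff_prime_eq_zero hp).2 hp0
  have hq : 1 < Nat.card (ResField p F) := Finite.one_lt_card
  have h1 : O2.red p F (a - b) = 0 := by rw [map_sub, h, sub_self]
  have h2 : (a - b) ^ Nat.card (ResField p F) = 0 :=
    pow_eq_zero_of_le hq (by rw [pow_two, mul_eq_zero_of_red h1 h1])
  rw [← sub_eq_zero, ← h2, hf, sub_pow_char_pow, ← hf, ha, hb]

lemma mk_teich_pow_card (x : ResField p F) :
    (Ideal.Quotient.mk _ (teich p F x) : O2 p F) ^ Nat.card (ResField p F) =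
      Ideal.Quotient.mk _ (teich p F x) := by
  rw [← map_pow, teich_pow_card]

/-- In the ramified case, the Teichmüller lift is a ring homomorphism modulo `𝔪²`. -/
def teichHom {f : ℕ} (hf : Nat.card (ResField p F) = p ^ f) (hp0 : (p : O2 p F) = 0) :
    ResField p F →+* O2 p F where
  toFun x := Ideal.Quotient.mk _ (teich p F x)
  map_zero' := eq_of_pow_card_eq_self hf hp0 (mk_teich_pow_card 0)
    (zero_pow Nat.card_pos.ne') (by rw [red_mk, residue_teich, map_zero])
  map_one' := eq_of_pow_card_eq_self hf hp0 (mk_teich_pow_card 1)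
    (one_pow _) (by rw [red_mk, residue_teich, map_one])
  map_mul' x y := eq_of_pow_card_eq_self hf hp0 (mk_teich_pow_card _)
    (by rw [mul_pow, mk_teich_pow_card, mk_teich_pow_card])
    (by rw [map_mul, red_mk, red_mk, red_mk, residue_teich, residue_teich, residue_teich])
  map_add' x y := by
    have : CharP (O2 p F) p := (CharP.charP_iff_prime_eq_zero Fact.out).2 hp0
    refine eq_of_pow_card_eq_self hf hp0 (mk_teich_pow_card _) ?_
      (by rw [map_add, red_mk, red_mk, red_mk, residue_teich, residue_teich, residue_teich])
    rw [hf, add_pow_char_pow, ← hf, mk_teich_pow_card, mk_teich_pow_card]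

variable {ϖ : valRing p F} (hϖ : maximalIdeal (valRing p F) = Ideal.span {ϖ})
  {f : ℕ} (hf : Nat.card (ResField p F) = p ^ f) (hp0 : (p : O2 p F) = 0)

include hϖ in
lemma red_mk_uniformizer : O2.red p F (Ideal.Quotient.mk _ ϖ) = 0 := by
  rw [red_mk, residue_eq_zero_iff, hϖ]
  exact Ideal.mem_span_singleton_self ϖ

lemma digits_symm (x : ResField p F × ResField p F) :
    (digits hϖ).symm x =
      teichHom hf hp0 x.1 + teichHom hf hp0 x.2 * Ideal.Quotient.mk _ ϖ := rfl

lemma eq_teichHom_add (t : O2 p F) :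
    t = teichHom hf hp0 (digits hϖ t).1 +
      teichHom hf hp0 (digits hϖ t).2 * Ideal.Quotient.mk _ ϖ := by
  rw [← digits_symm hϖ, Equiv.symm_apply_apply]

lemma digits_teichHom_add (x y : ResField p F) :
    digits hϖ (teichHom hf hp0 x + teichHom hf hp0 y * Ideal.Quotient.mk _ ϖ) = (x, y) := by
  rw [← digits_symm hϖ hf hp0 (x, y), Equiv.apply_symm_apply]

lemma digits_fst (t : O2 p F) : (digits hϖ t).1 = O2.red p F t := by
  obtain ⟨⟨x, y⟩, rfl⟩ := (digits hϖ).symm.surjective t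
  rw [Equiv.apply_symm_apply]
  change x = residue _ (teich p F x + teich p F y * ϖ)
  rw [map_add, map_mul, residue_teich, ← red_mk ϖ, red_mk_uniformizer hϖ, mul_zero, add_zero]

include hf hp0 in
lemma digits_add (s t : O2 p F) : digits hϖ (s + t) = digits hϖ s + digits hϖ t := by
  rw [← (digits hϖ).symm.apply_eq_iff_eq, Equiv.symm_apply_apply, digits_symm hϖ hf hp0]
  conv_lhs => rw [eq_teichHom_add hϖ hf hp0 s, eq_teichHom_add hϖ hf hp0 t]
  simp only [Prod.fst_add, Prod.snd_add, map_add]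
  ring

include hf hp0 in
lemma digits_mul (s t : O2 p F) :
    digits hϖ (s * t) = ((digits hϖ s).1 * (digits hϖ t).1,
      (digits hϖ s).1 * (digits hϖ t).2 + (digits hϖ s).2 * (digits hϖ t).1) := by
  rw [← (digits hϖ).symm.apply_eq_iff_eq, Equiv.symm_apply_apply, digits_symm hϖ hf hp0]
  conv_lhs => rw [eq_teichHom_add hϖ hf hp0 s, eq_teichHom_add hϖ hf hp0 t]
  simp only [map_add, map_mul]
  have h := mul_eq_zero_of_red (red_mk_uniformizer hϖ) (red_mk_uniformizer hϖ)
  linear_combination (teichHom hf hp0 (digits hϖ s).2 * teichHom hf hp0 (digits hϖ t).2) * h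

include hf hp0 in
lemma digits_one : digits hϖ 1 = (1, 0) := by
  have h := digits_teichHom_add hϖ hf hp0 1 0
  rwa [map_one (teichHom hf hp0), map_zero (teichHom hf hp0), zero_mul, add_zero] at h

include hf hp0 in
lemma digits_inv (u : (O2 p F)ˣ) :
    digits hϖ (u⁻¹ : (O2 p F)ˣ) =
      ((digits hϖ u).1⁻¹, - (digits hϖ u).2 * ((digits hϖ u).1⁻¹) ^ 2) := by
  have h := digits_mul hϖ hf hp0 u (u⁻¹ : (O2 p F)ˣ)
  rw [Units.mul_inv, digits_one hϖ hf hp0, Prod.ext_iff] at h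
  obtain ⟨h1, h2⟩ := h
  simp only at h1 h2
  have h0 : (digits hϖ u).1 ≠ 0 := left_ne_zero_of_mul_eq_one h1.symm
  have h3 : (digits hϖ ((u⁻¹ : (O2 p F)ˣ) : O2 p F)).1 = (digits hϖ u).1⁻¹ :=
    eq_inv_of_mul_eq_one_right h1.symm
  refine Prod.ext h3 ?_
  rw [h3] at h2
  simp only
  field_simp
  field_simp at h2
  linear_combination -h2

end Arithmetic

/-! ### Functions on the big cell -/

section Cell

open Matrix

variable {R : Type*} [CommRing R]

/-- The element `(1 t; 0 1)`. -/
def upper (t : R) : GL (Fin 2) R :=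
  ⟨!![1, t; 0, 1], !![1, -t; 0, 1], by simp [Matrix.one_fin_two], by simp [Matrix.one_fin_two]⟩

/-- The element `(a 0; 0 b)`. -/
def torus (a b : Rˣ) : GL (Fin 2) R :=
  ⟨!![(a : R), 0; 0, (b : R)], !![((a⁻¹ : Rˣ) : R), 0; 0, ((b⁻¹ : Rˣ) : R)],
    by simp [Matrix.one_fin_two], by simp [Matrix.one_fin_two]⟩

lemma mul_upper_one_zero (x : GL (Fin 2) R) (t : R) : (x * upper t).1 1 0 = x.1 1 0 := by
  simp [upper, Matrix.mul_apply, Fin.sum_univ_two]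

lemma mul_upper_one_one (x : GL (Fin 2) R) (t : R) :
    (x * upper t).1 1 1 = x.1 1 0 * t + x.1 1 1 := by
  simp [upper, Matrix.mul_apply, Fin.sum_univ_two]

lemma mul_torus_one_zero (x : GL (Fin 2) R) (a b : Rˣ) :
    (x * torus a b).1 1 0 = x.1 1 0 * a := by
  simp [torus, Matrix.mul_apply, Fin.sum_univ_two]

lemma mul_torus_one_one (x : GL (Fin 2) R) (a b : Rˣ) :
    (x * torus a b).1 1 1 = x.1 1 1 * b := by
  simp [torus, Matrix.mul_apply, Fin.sum_univ_two]

lemma mul_weyl_one_zero (x : GL (Fin 2) R) : (x * weyl).1 1 0 = x.1 1 1 := by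
  simp [weyl, Matrix.mul_apply, Fin.sum_univ_two]

lemma mul_weyl_one_one (x : GL (Fin 2) R) : (x * weyl).1 1 1 = x.1 1 0 := by
  simp [weyl, Matrix.mul_apply, Fin.sum_univ_two]

lemma mul_xiMat_one_zero (x : GL (Fin 2) R) (t : R) :
    (x * xiMat t).1 1 0 = x.1 1 0 * t + x.1 1 1 := by
  simp [xiMat, Matrix.mul_apply, Fin.sum_univ_two]

lemma mul_xiMat_one_one (x : GL (Fin 2) R) (t : R) : (x * xiMat t).1 1 1 = x.1 1 0 := by
  simp [xiMat, Matrix.mul_apply, Fin.sum_univ_two]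

lemma weyl_mul_weyl : (weyl : GL (Fin 2) R) * weyl = 1 := by
  ext i j
  fin_cases i <;> fin_cases j <;> simp [weyl, Matrix.mul_apply, Fin.sum_univ_two]

lemma upper_add (s t : R) : upper (s + t) = upper s * upper t := by
  ext i j
  fin_cases i <;> fin_cases j <;>
    simp [upper, Matrix.mul_apply, Fin.sum_univ_two, add_comm]

lemma torus_mul_weyl (a b : Rˣ) : torus a b * weyl = weyl * torus b a := by
  ext i j
  fin_cases i <;> fin_cases j <;> simp [weyl, torus, Matrix.mul_apply, Fin.sum_univ_two]

/-- A submonoid of `GL₂(R)`, for `R` local, is everything if it contains `w`, the upper triangular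
unipotent and the diagonal matrices: a matrix with invertible upper left entry is a product of a
lower unipotent (a conjugate by `w` of an upper unipotent), a diagonal and an upper unipotent
matrix, and one of `x`, `w x` has an invertible upper left entry. -/
lemma submonoid_eq_top_of_generators [IsLocalRing R] (S : Submonoid (GL (Fin 2) R))
    (hw : weyl ∈ S) (hu : ∀ t, upper t ∈ S) (ht : ∀ a b, torus a b ∈ S) : S = ⊤ := by
  have key : ∀ x : GL (Fin 2) R, IsUnit (x.1 0 0) → x ∈ S := by
    intro x hx
    obtain ⟨a, ha⟩ := hx
    have hdet : IsUnit (x.1 0 0 * x.1 1 1 - x.1 0 1 * x.1 1 0) := by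
      rw [← Matrix.det_fin_two]
      exact (Matrix.isUnit_iff_isUnit_det _).1 x.isUnit
    obtain ⟨δ, hδ⟩ := hdet
    rw [← ha] at hδ
    have hinv : (a : R) * ((a⁻¹ : Rˣ) : R) = 1 := a.mul_inv
    have e : x = weyl * upper (x.1 1 0 * ((a⁻¹ : Rˣ) : R)) * weyl * torus a (a⁻¹ * δ) *
        upper (((a⁻¹ : Rˣ) : R) * x.1 0 1) := by
      ext i j
      fin_cases i <;> fin_cases j <;>
        simp [weyl, torus, upper, Matrix.mul_apply, Fin.sum_univ_two, ← ha, hδ]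
      linear_combination (-x.1 1 1) * hinv
    rw [e]
    exact S.mul_mem (S.mul_mem (S.mul_mem (S.mul_mem hw (hu _)) hw) (ht _ _)) (hu _)
  refine top_unique fun x _ => ?_
  by_cases h : IsUnit (x.1 0 0)
  · exact key x h
  · have hdet : IsUnit (x.1 0 0 * x.1 1 1 - x.1 0 1 * x.1 1 0) := by
      rw [← Matrix.det_fin_two]
      exact (Matrix.isUnit_iff_isUnit_det _).1 x.isUnit
    rw [sub_eq_add_neg] at hdet
    have h2 : IsUnit (x.1 1 0) := by
      rcases IsLocalRing.isUnit_or_isUnit_of_isUnit_add hdet with h1 | h1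
      · exact absurd (isUnit_of_mul_isUnit_left h1) h
      · exact isUnit_of_mul_isUnit_right (IsUnit.neg_iff _ |>.1 h1)
    have h3 := S.mul_mem hw (key (weyl * x) (by
      simpa [weyl, Matrix.mul_apply, Fin.sum_univ_two] using h2))
    rwa [← mul_assoc, weyl_mul_weyl, one_mul] at h3

variable {p : ℕ} [Fact p.Prime] {F : Type*} [Field F] [Algebra ℚ_[p] F]
  [FiniteDimensional ℚ_[p] F]

instance isLocalRing_O2 : IsLocalRing (O2 p F) :=
  IsLocalRing.of_nonunits_add fun a b ha hb => by
    rw [mem_nonunits_iff, isUnit_iff_red_ne_zero, not_not] at *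
    rw [map_add, ha, hb, add_zero]

lemma isUnit_bottom_row (x : GL (Fin 2) (O2 p F)) (h : ¬ IsUnit (x.1 1 0)) :
    IsUnit (x.1 1 1) := by
  have hdet : IsUnit (x.1 0 0 * x.1 1 1 + -(x.1 0 1 * x.1 1 0)) := by
    rw [← sub_eq_add_neg, ← Matrix.det_fin_two]
    exact (Matrix.isUnit_iff_isUnit_det _).1 x.isUnit
  rcases IsLocalRing.isUnit_or_isUnit_of_isUnit_add hdet with h1 | h1
  · exact isUnit_of_mul_isUnit_right h1
  · exact absurd (isUnit_of_mul_isUnit_right (IsUnit.neg_iff _ |>.1 h1)) h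

variable (E : Type*) [Field E] [Algebra (ResField p F) E]
  {ϖ : valRing p F} (hϖ : IsLocalRing.maximalIdeal (valRing p F) = Ideal.span {ϖ})

/-- The element of `V_{2,r}` that is supported on the big cell and corresponds there to the
function `h` of the coordinate `λ`. -/
def cell (r : Expo (ResField p F)) (h : O2 p F → E) : PSSpace E r :=
  letI := finite_O2 hϖ
  letI := Fintype.ofFinite (O2 p F)
  ∑ t : O2 p F, indTmul (chiRep E r) (xiMat t) (h t)

open scoped Classical in
lemma indTmul_xiMat_apply (r : Expo (ResField p F)) (t : O2 p F) (v : E)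
    (x : GL (Fin 2) (O2 p F)) :
    (indTmul (chiRep E r) (xiMat t) v).1 x =
      if x.1 1 0 * t + x.1 1 1 = 0 then
        algebraMap (ResField p F) E (Expo.pow (O2.red p F (x.1 1 0)) r) * v else 0 := by
  have hb : x * xiMat t ∈ borel (O2 p F) ↔ x.1 1 0 * t + x.1 1 1 = 0 := by
    rw [← mul_xiMat_one_zero]
    rfl
  by_cases h : x.1 1 0 * t + x.1 1 1 = 0
  · rw [if_pos h]
    refine (dif_pos (hb.2 h)).trans ?_
    change algebraMap (ResField p F) E
      (Expo.pow (O2.red p F ((x * xiMat t).1 1 1)) r) • v = _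
    rw [mul_xiMat_one_one, smul_eq_mul]
  · rw [if_neg h]
    exact dif_neg (mt hb.1 h)

lemma cell_apply_of_isUnit (r : Expo (ResField p F)) (h : O2 p F → E)
    (x : GL (Fin 2) (O2 p F)) (c : (O2 p F)ˣ) (hc : x.1 1 0 = c) :
    (cell E hϖ r h).1 x = algebraMap (ResField p F) E (Expo.pow (O2.red p F c) r) *
      h (-(x.1 1 1 * (c⁻¹ : (O2 p F)ˣ))) := by
  classical
  have := finite_O2 hϖ
  let _ := Fintype.ofFinite (O2 p F)
  have hmul : (c : O2 p F) * ((c⁻¹ : (O2 p F)ˣ) : O2 p F) = 1 := c.mul_inv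
  rw [cell, Submodule.coe_sum, Finset.sum_apply]
  simp_rw [indTmul_xiMat_apply]
  rw [Finset.sum_eq_single (-(x.1 1 1 * (c⁻¹ : (O2 p F)ˣ)))]
  · rw [if_pos, hc]
    rw [hc]
    linear_combination (-x.1 1 1) * hmul
  · intro t _ ht
    refine if_neg fun h0 => ht ?_
    rw [hc] at h0
    linear_combination ((c⁻¹ : (O2 p F)ˣ) : O2 p F) * h0 - t * hmul
  · exact fun h0 => absurd (Finset.mem_univ _) h0

lemma cell_apply_of_not_isUnit (r : Expo (ResField p F)) (h : O2 p F → E)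
    (x : GL (Fin 2) (O2 p F)) (hc : ¬ IsUnit (x.1 1 0)) : (cell E hϖ r h).1 x = 0 := by
  classical
  have := finite_O2 hϖ
  let _ := Fintype.ofFinite (O2 p F)
  rw [cell, Submodule.coe_sum, Finset.sum_apply]
  refine Finset.sum_eq_zero fun t _ => ?_
  rw [indTmul_xiMat_apply, if_neg]
  intro h0
  have hd := isUnit_bottom_row x hc
  rw [eq_neg_of_add_eq_zero_right h0, IsUnit.neg_iff] at hd
  exact hc (isUnit_of_mul_isUnit_left hd)

variable {E}

lemma PSSpace_ext {r : Expo (ResField p F)} {u v : PSSpace E r}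
    (h : ∀ x, (¬ IsUnit (x.1 1 0) → u.1 x = v.1 x) ∧
      (∀ c : (O2 p F)ˣ, x.1 1 0 = c → u.1 x = v.1 x)) : u = v := by
  refine Subtype.ext (funext fun x => ?_)
  by_cases hx : IsUnit (x.1 1 0)
  · obtain ⟨c, hc⟩ := hx
    exact (h x).2 c hc.symm
  · exact (h x).1 hx

lemma PS_apply (r : Expo (ResField p F)) (g x : GL (Fin 2) (O2 p F)) (v : PSSpace E r) :
    (PS E r g v).1 x = v.1 (x * g) := rfl

lemma cell_add (r : Expo (ResField p F)) (h h' : O2 p F → E) :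
    cell E hϖ r (h + h') = cell E hϖ r h + cell E hϖ r h' := by
  refine PSSpace_ext fun x => ⟨fun hx => ?_, fun c hc => ?_⟩ <;>
    rw [Submodule.coe_add, Pi.add_apply]
  · simp only [cell_apply_of_not_isUnit E hϖ _ _ x hx, add_zero]
  · simp only [cell_apply_of_isUnit E hϖ _ _ x c hc, Pi.add_apply, mul_add]

lemma cell_smul (r : Expo (ResField p F)) (a : E) (h : O2 p F → E) :
    cell E hϖ r (a • h) = a • cell E hϖ r h := by
  refine PSSpace_ext fun x => ⟨fun hx => ?_, fun c hc => ?_⟩ <;>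
    rw [Submodule.coe_smul, Pi.smul_apply]
  · simp only [cell_apply_of_not_isUnit E hϖ _ _ x hx, smul_zero]
  · simp only [cell_apply_of_isUnit E hϖ _ _ x c hc, Pi.smul_apply, smul_eq_mul, mul_left_comm]

/-- `cell` as a linear map. -/
def cellLin (r : Expo (ResField p F)) : (O2 p F → E) →ₗ[E] PSSpace E r where
  toFun := cell E hϖ r
  map_add' := cell_add hϖ r
  map_smul' := cell_smul hϖ r

lemma upper_cell (r : Expo (ResField p F)) (t : O2 p F) (h : O2 p F → E) :
    PS E r (upper t) (cell E hϖ r h) = cell E hϖ r fun l => h (l - t) := by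
  refine PSSpace_ext fun x => ⟨fun hx => ?_, fun c hc => ?_⟩ <;> rw [PS_apply]
  · rw [cell_apply_of_not_isUnit E hϖ _ _ x hx, cell_apply_of_not_isUnit]
    rwa [mul_upper_one_zero]
  · rw [cell_apply_of_isUnit E hϖ _ _ x c hc, cell_apply_of_isUnit E hϖ _ _ (x * upper t) c
      (by rw [mul_upper_one_zero, hc]), mul_upper_one_one, hc]
    congr 2
    linear_combination (-t) * c.mul_inv

lemma torus_cell (r : Expo (ResField p F)) (a b : (O2 p F)ˣ) (h : O2 p F → E) :
    PS E r (torus a b) (cell E hϖ r h) =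
      algebraMap (ResField p F) E (Expo.pow (O2.red p F a) r) •
        cell E hϖ r fun l => h (l * ((a⁻¹ * b : (O2 p F)ˣ) : O2 p F)) := by
  refine PSSpace_ext fun x => ⟨fun hx => ?_, fun c hc => ?_⟩ <;>
    rw [PS_apply, Submodule.coe_smul, Pi.smul_apply]
  · rw [cell_apply_of_not_isUnit E hϖ _ _ x hx, cell_apply_of_not_isUnit, smul_zero]
    rw [mul_torus_one_zero]
    exact fun h0 => hx (isUnit_of_mul_isUnit_left h0)
  · rw [cell_apply_of_isUnit E hϖ _ _ x c hc, cell_apply_of_isUnit E hϖ _ _ (x * torus a b)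
      (c * a) (by rw [mul_torus_one_zero, hc, Units.val_mul]), mul_torus_one_one, Units.val_mul,
      map_mul, Expo.mul_pow, map_mul, smul_eq_mul, _root_.mul_inv_rev, Units.val_mul, Units.val_mul,
      mul_comm (algebraMap _ _ (Expo.pow (O2.red p F c) r)), mul_assoc]
    congr 3
    ring

open scoped Classical in
/-- The function on the big cell obtained from `h` by the action of `w`, away from the points with
`λ₀ = 0`, which `w` moves out of the big cell. -/
def flip (r : Expo (ResField p F)) (h : O2 p F → E) (l : O2 p F) : E :=
  if hl : IsUnit l then
    algebraMap (ResField p F) E (Expo.pow (-O2.red p F l) r) *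
      h ((hl.unit⁻¹ : (O2 p F)ˣ) : O2 p F) else 0

lemma flip_coe (r : Expo (ResField p F)) (h : O2 p F → E) (u : (O2 p F)ˣ) :
    flip r h u = algebraMap (ResField p F) E (Expo.pow (-O2.red p F u) r) *
      h ((u⁻¹ : (O2 p F)ˣ) : O2 p F) := by
  rw [flip, dif_pos u.isUnit, IsUnit.unit_of_val_units]

lemma flip_of_not_isUnit (r : Expo (ResField p F)) (h : O2 p F → E) {l : O2 p F}
    (hl : ¬ IsUnit l) : flip r h l = 0 := dif_neg hl

/-- On the big cell, the action of `w` is given by `flip`. -/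
lemma weyl_cell_apply (r : Expo (ResField p F)) (h : O2 p F → E)
    (x : GL (Fin 2) (O2 p F)) (c : (O2 p F)ˣ) (hc : x.1 1 0 = c) :
    (PS E r weyl (cell E hϖ r h)).1 x = algebraMap (ResField p F) E (Expo.pow (O2.red p F c) r) *
      flip r h (-(x.1 1 1 * (c⁻¹ : (O2 p F)ˣ))) := by
  rw [PS_apply]
  by_cases hd : IsUnit (x.1 1 1)
  · obtain ⟨d, hd⟩ := hd
    rw [cell_apply_of_isUnit E hϖ _ _ (x * weyl) d (by rw [mul_weyl_one_zero, hd]),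
      mul_weyl_one_one, ← hd, hc]
    have e : -((d : O2 p F) * ((c⁻¹ : (O2 p F)ˣ) : O2 p F)) = ((-(d * c⁻¹) : (O2 p F)ˣ) : O2 p F) :=
      by simp
    rw [e, flip_coe, ← mul_assoc, ← map_mul, ← Expo.mul_pow]
    congr 3
    rw [← map_neg, ← map_mul, Units.val_neg, neg_neg, Units.val_mul]
    congr 1
    linear_combination (-(d : O2 p F)) * c.mul_inv
  · rw [cell_apply_of_not_isUnit E hϖ _ _ (x * weyl) (by rwa [mul_weyl_one_zero]),
      flip_of_not_isUnit, mul_zero]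
    rw [IsUnit.neg_iff]
    exact fun h0 => hd (isUnit_of_mul_isUnit_left h0)

lemma weyl_cell (r : Expo (ResField p F)) {h : O2 p F → E} (hh : ∀ l, ¬ IsUnit l → h l = 0) :
    PS E r weyl (cell E hϖ r h) = cell E hϖ r (flip r h) := by
  refine PSSpace_ext fun x => ⟨fun hx => ?_, fun c hc => ?_⟩
  · obtain ⟨d, hd⟩ := isUnit_bottom_row x hx
    rw [PS_apply, cell_apply_of_not_isUnit E hϖ _ _ x hx,
      cell_apply_of_isUnit E hϖ _ _ (x * weyl) d (by rw [mul_weyl_one_zero, hd]),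
      mul_weyl_one_one, hh, mul_zero]
    rw [IsUnit.neg_iff]
    exact fun h0 => hx (isUnit_of_mul_isUnit_left h0)
  · rw [weyl_cell_apply hϖ r h x c hc, cell_apply_of_isUnit E hϖ _ _ x c hc]

/-- Although `w` moves part of the big cell out of it, the difference on the left-hand side is
supported on the big cell, since `c ^ 2 = 0` for every non-unit `c` of `𝒪₂`. -/
lemma upper_weyl_cell (r : Expo (ResField p F)) (t : O2 p F) (h : O2 p F → E) :
    PS E r (upper t) (PS E r weyl (cell E hϖ r h)) - PS E r weyl (cell E hϖ r h) =
      PS E r (upper t) (cell E hϖ r (flip r h)) - cell E hϖ r (flip r h) := by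
  have key : ∀ x y : GL (Fin 2) (O2 p F), y.1 1 0 = x.1 1 0 →
      y.1 1 1 = x.1 1 0 * t + x.1 1 1 →
      (PS E r weyl (cell E hϖ r h)).1 y - (PS E r weyl (cell E hϖ r h)).1 x =
        (cell E hϖ r (flip r h)).1 y - (cell E hϖ r (flip r h)).1 x := by
    intro x y h10 h11
    by_cases hx : IsUnit (x.1 1 0)
    · obtain ⟨c, hc⟩ := hx
      have hy : y.1 1 0 = c := by rw [h10, hc]
      rw [weyl_cell_apply hϖ r h x c hc.symm, weyl_cell_apply hϖ r h y c hy,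
        cell_apply_of_isUnit E hϖ _ _ x c hc.symm, cell_apply_of_isUnit E hϖ _ _ y c hy]
    · have hy : ¬ IsUnit (y.1 1 0) := by rwa [h10]
      rw [cell_apply_of_not_isUnit E hϖ _ _ x hx, cell_apply_of_not_isUnit E hϖ _ _ y hy,
        sub_self, sub_eq_zero, PS_apply, PS_apply]
      obtain ⟨d, hd⟩ := isUnit_bottom_row x hx
      obtain ⟨d', hd'⟩ := isUnit_bottom_row y hy
      rw [cell_apply_of_isUnit E hϖ _ _ (x * weyl) d (by rw [mul_weyl_one_zero, hd]),
        cell_apply_of_isUnit E hϖ _ _ (y * weyl) d' (by rw [mul_weyl_one_zero, hd']),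
        mul_weyl_one_one, mul_weyl_one_one, h10]
      have hr : O2.red p F (x.1 1 0) = 0 := by
        by_contra h0
        exact hx (isUnit_iff_red_ne_zero.2 h0)
      have hsq := mul_eq_zero_of_red hr hr
      rw [h11, ← hd] at hd'
      rw [show O2.red p F d' = O2.red p F d by rw [hd', map_add, map_mul, hr, zero_mul, zero_add]]
      congr 2
      rw [neg_inj]
      have h1 := d.mul_inv
      have h2 := d'.mul_inv
      generalize x.1 1 0 = c at *
      rw [hd'] at h2
      generalize ((d⁻¹ : (O2 p F)ˣ) : O2 p F) = di at *
      generalize ((d'⁻¹ : (O2 p F)ˣ) : O2 p F) = di' at *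
      linear_combination (-c * di') * h1 + c * di * h2 - di * di' * t * hsq
  exact Subtype.ext (funext fun x => key x _ (mul_upper_one_zero x t) (mul_upper_one_one x t))

end Cell

/-! ### The action on the vectors `f_{(j₀, j₁)}` -/

section BasisAction

variable {p : ℕ} [Fact p.Prime] {F : Type*} [Field F] [Algebra ℚ_[p] F]
  [FiniteDimensional ℚ_[p] F] {E : Type*} [Field E] [Algebra (ResField p F) E]
  {ϖ : valRing p F} (hϖ : IsLocalRing.maximalIdeal (valRing p F) = Ideal.span {ϖ})
  {f : ℕ} (hf : Nat.card (ResField p F) = p ^ f) (hp0 : (p : O2 p F) = 0)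

variable (E) in
/-- The function `λ ↦ λ₀ ^ j₀ λ₁ ^ j₁` on `𝒪₂`. -/
def mono (j₀ j₁ : Expo (ResField p F)) (l : O2 p F) : E :=
  algebraMap (ResField p F) E (Expo.pow (digits hϖ l).1 j₀ * Expo.pow (digits hϖ l).2 j₁)

lemma basisFin_eq_cell (r j₀ j₁ : Expo (ResField p F)) :
    basisFin E hϖ r j₀ j₁ = cell E hϖ r (mono E hϖ j₀ j₁) := rfl

/-- The binomial expansion of `A * (t X + Y) ^ n` inside `cell`. -/
lemma cell_sub_cell_eq_binomSum (r : Expo (ResField p F)) (n : ℕ) {g : ℕ → O2 p F → E}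
    {h : O2 p F → E} (t : ResField p F) (A X Y : O2 p F → ResField p F)
    (hg : ∀ i l, g i l = algebraMap (ResField p F) E (A l * (X l ^ i * Y l ^ (n - i))))
    (hh : ∀ l, h l = algebraMap (ResField p F) E (A l * (t * X l + Y l) ^ n)) :
    cell E hϖ r h - cell E hϖ r (g 0) =
      binomSum (E := E) n (fun i => cell E hϖ r (g i)) t := by
  have h1 : h = ∑ i ∈ Finset.range (n + 1),
      algebraMap (ResField p F) E (t ^ i * n.choose i) • g i := by
    funext l
    rw [hh, Finset.sum_apply, add_pow, Finset.mul_sum, map_sum]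
    refine Finset.sum_congr rfl fun i _ => ?_
    rw [Pi.smul_apply, smul_eq_mul, hg, ← map_mul, mul_pow]
    congr 1
    ring
  have h2 : cell E hϖ r h = ∑ i ∈ Finset.range (n + 1),
      algebraMap (ResField p F) E (t ^ i * n.choose i) • cell E hϖ r (g i) := by
    rw [h1]
    change cellLin hϖ r _ = _
    rw [map_sum]
    refine Finset.sum_congr rfl fun i _ => ?_
    rw [map_smul]
    rfl
  rw [h2, binomSum, ← Finset.sum_erase_add (Finset.range (n + 1)) _ (a := 0) (by simp)]
  simp

include hf hp0

lemma digits_teichHom (t : ResField p F) : digits hϖ (teichHom hf hp0 t) = (t, 0) := by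
  have h := digits_teichHom_add hϖ hf hp0 t 0
  rwa [map_zero (teichHom hf hp0), zero_mul, add_zero] at h

lemma digits_teichHom_mul (t : ResField p F) :
    digits hϖ (teichHom hf hp0 t * Ideal.Quotient.mk _ ϖ) = (0, t) := by
  have h := digits_teichHom_add hϖ hf hp0 0 t
  rwa [map_zero (teichHom hf hp0), zero_add] at h

lemma upper_teichHom_basisFin (r j₁ : Expo (ResField p F)) (n : ℕ) (t : ResField p F) :
    PS E r (upper (-teichHom hf hp0 t)) (basisFin E hϖ r n j₁) - basisFin E hϖ r n j₁ =
      binomSum (E := E) n (fun i => basisFin E hϖ r (n - i : ℕ) j₁) t := by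
  rw [basisFin_eq_cell, upper_cell]
  refine cell_sub_cell_eq_binomSum hϖ r n (g := fun i => mono E hϖ (n - i : ℕ) j₁) t
    (fun l => Expo.pow (digits hϖ l).2 j₁) 1 (fun l => (digits hϖ l).1) (fun i l => ?_) fun l => ?_
  · rw [mono, Expo.pow_coe, Pi.one_apply, one_pow, one_mul, mul_comm]
  · rw [mono, Expo.pow_coe, sub_neg_eq_add, digits_add hϖ hf hp0, digits_teichHom hϖ,
      Prod.fst_add, Prod.snd_add, add_zero, Pi.one_apply, mul_one, mul_comm, add_comm t]

lemma upper_teichHom_mul_basisFin (r j₀ : Expo (ResField p F)) (n : ℕ) (t : ResField p F) :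
    PS E r (upper (-(teichHom hf hp0 t * Ideal.Quotient.mk _ ϖ))) (basisFin E hϖ r j₀ n) -
        basisFin E hϖ r j₀ n =
      binomSum (E := E) n (fun i => basisFin E hϖ r j₀ (n - i : ℕ)) t := by
  rw [basisFin_eq_cell, upper_cell]
  refine cell_sub_cell_eq_binomSum hϖ r n (g := fun i => mono E hϖ j₀ (n - i : ℕ)) t
    (fun l => Expo.pow (digits hϖ l).1 j₀) 1 (fun l => (digits hϖ l).2) (fun i l => ?_) fun l => ?_
  · rw [mono, Expo.pow_coe, Pi.one_apply, one_pow, one_mul]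
  · rw [mono, Expo.pow_coe, sub_neg_eq_add, digits_add hϖ hf hp0, digits_teichHom_mul hϖ,
      Prod.fst_add, Prod.snd_add, add_zero, Pi.one_apply, mul_one, add_comm t]

/-- With `u = a⁻¹ b`, the action of a diagonal matrix substitutes `λ₀ u₀` for `λ₀` and
`λ₀ u₁ + λ₁ u₀` for `λ₁`. -/
lemma torus_basisFin (r j₀ : Expo (ResField p F)) (n : ℕ) (a b : (O2 p F)ˣ)
    {u : ResField p F × ResField p F} (hu : digits hϖ ((a⁻¹ * b : (O2 p F)ˣ) : O2 p F) = u) :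
    PS E r (torus a b) (basisFin E hϖ r j₀ n) =
      algebraMap (ResField p F) E
        (Expo.pow (O2.red p F a) r * (Expo.pow u.1 j₀ * u.1 ^ n)) •
        (basisFin E hϖ r j₀ n + binomSum (E := E) n
          (fun i => basisFin E hϖ r (j₀ + (i : Expo (ResField p F))) (n - i : ℕ)) (u.2 / u.1)) := by
  have hu0 : u.1 ≠ 0 := by
    rw [← hu, digits_fst]
    exact isUnit_iff_red_ne_zero.1 (Units.isUnit _)
  have h1 := cell_sub_cell_eq_binomSum hϖ r n (E := E)
    (g := fun i => mono E hϖ (j₀ + (i : Expo (ResField p F))) (n - i : ℕ)) (u.2 / u.1)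
    (fun l => Expo.pow (digits hϖ l).1 j₀) (fun l => (digits hϖ l).1) (fun l => (digits hϖ l).2)
    (fun i l => by rw [mono, Expo.pow_add, Expo.pow_coe, Expo.pow_coe, mul_assoc])
    (h := fun l => algebraMap (ResField p F) E (Expo.pow (digits hϖ l).1 j₀ *
      (u.2 / u.1 * (digits hϖ l).1 + (digits hϖ l).2) ^ n)) (fun l => rfl)
  have h2 : basisFin E hϖ r j₀ n = cell E hϖ r
      (mono E hϖ (j₀ + ((0 : ℕ) : Expo (ResField p F))) (n - 0 : ℕ)) := by
    rw [basisFin_eq_cell]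
    congr 2
    exact (add_zero j₀).symm
  rw [← h2, sub_eq_iff_eq_add'] at h1
  refine Eq.trans ?_ (congrArg (fun v => algebraMap (ResField p F) E
    (Expo.pow (O2.red p F a) r * (Expo.pow u.1 j₀ * u.1 ^ n)) • v) h1)
  rw [basisFin_eq_cell, torus_cell, map_mul, mul_smul]
  refine congrArg (_ • ·) ?_
  rw [← cell_smul]
  congr 2
  funext l
  rw [mono, digits_mul hϖ hf hp0, hu, Pi.smul_apply, smul_eq_mul, ← map_mul]
  congr 1
  simp only [Expo.mul_pow, Expo.pow_coe]
  rw [show (digits hϖ l).1 * u.2 + (digits hϖ l).2 * u.1 =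
    u.1 * (u.2 / u.1 * (digits hϖ l).1 + (digits hϖ l).2) by field_simp, mul_pow]
  ring

/-- For a unit `λ`, inversion gives `(λ⁻¹)₀ = λ₀⁻¹` and `(λ⁻¹)₁ = -λ₁ λ₀⁻²`, which explains the
exponent `a = r - 2 j₁ - j₀`. The condition `a ≠ 0` makes the right-hand side vanish at the
non-units, as the left-hand side does. -/
lemma flip_mono {r j₀ j₁ a : Expo (ResField p F)} (ha : a ≠ 0) (hr : 2 • j₁ + (j₀ + a) = r) :
    flip r (mono E hϖ j₀ j₁) = algebraMap (ResField p F) E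
      (Expo.pow (-1) r * Expo.pow (-1) j₁) • mono E hϖ a j₁ := by
  funext l
  rw [Pi.smul_apply, smul_eq_mul]
  by_cases hl : IsUnit l
  · obtain ⟨u, rfl⟩ := hl
    have hu := isUnit_iff_red_ne_zero.1 u.isUnit
    rw [flip_coe, mono, mono, digits_inv hϖ hf hp0, ← digits_fst hϖ, ← map_mul, ← map_mul]
    rw [← digits_fst hϖ] at hu
    congr 1
    generalize digits hϖ (u : O2 p F) = d at *
    simp only
    rw [neg_mul, neg_eq_neg_one_mul, neg_eq_neg_one_mul (_ * _), pow_two d.1⁻¹, Expo.mul_pow (-1),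
      Expo.mul_pow (-1), Expo.mul_pow d.2, Expo.mul_pow _⁻¹, Expo.inv_pow,
      Expo.inv_pow]
    have e : Expo.pow d.1 r =
        Expo.pow d.1 j₁ ^ 2 * (Expo.pow d.1 j₀ *
          Expo.pow d.1 a) := by
      rw [← hr, Expo.pow_add, Expo.pow_add, Expo.pow_nsmul]
    rw [e]
    have h1 := Expo.pow_ne_zero hu j₁
    have h2 := Expo.pow_ne_zero hu j₀
    field_simp
  · rw [flip_of_not_isUnit _ _ hl, mono, digits_fst,
      show O2.red p F l = 0 from not_not.1 (mt isUnit_iff_red_ne_zero.2 hl), Expo.zero_pow ha,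
      zero_mul, map_zero, mul_zero]

lemma weyl_basisFin {r j₀ j₁ a : Expo (ResField p F)} (hj₀ : j₀ ≠ 0) (ha : a ≠ 0)
    (hr : 2 • j₁ + (j₀ + a) = r) :
    PS E r weyl (basisFin E hϖ r j₀ j₁) = algebraMap (ResField p F) E
      (Expo.pow (-1) r * Expo.pow (-1) j₁) • basisFin E hϖ r a j₁ := by
  rw [basisFin_eq_cell, weyl_cell, flip_mono hϖ hf hp0 ha hr, cell_smul]
  · rfl
  · intro l hl
    rw [mono, digits_fst, show O2.red p F l = 0 from not_not.1 (mt isUnit_iff_red_ne_zero.2 hl),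
      Expo.zero_pow hj₀, zero_mul, map_zero]

/-- Up to sign, an upper unipotent changes `f_{(∞, j₁)}` in the same way as
`f_{(r - 2 j₁, j₁)}`. -/
lemma upper_weyl_basisFin {r j₁ s : Expo (ResField p F)} (hs : Expo.IsSub r (2 • j₁) s)
    (t : O2 p F) :
    PS E r (upper t) (PS E r weyl (basisFin E hϖ r 0 j₁)) - PS E r weyl (basisFin E hϖ r 0 j₁) =
      algebraMap (ResField p F) E (Expo.pow (-1) r * Expo.pow (-1) j₁) •
        (PS E r (upper t) (basisFin E hϖ r s j₁) - basisFin E hϖ r s j₁) := by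
  rw [basisFin_eq_cell, upper_weyl_cell,
    flip_mono hϖ hf hp0 hs.2.1 (by rw [zero_add, hs.2.2]), cell_smul, map_smul, smul_sub]
  rfl

omit hf hp0 in
lemma algebraMap_sign_ne_zero (r j₁ : Expo (ResField p F)) :
    algebraMap (ResField p F) E (Expo.pow (-1) r * Expo.pow (-1) j₁) ≠ 0 :=
  (map_ne_zero _).2 (mul_ne_zero (Expo.pow_ne_zero (neg_ne_zero.2 one_ne_zero) _)
    (Expo.pow_ne_zero (neg_ne_zero.2 one_ne_zero) _))

end BasisAction

/-! ### Chains in the preorder on indices -/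

section Chains

variable {k : Type*} [Field k] {p f : ℕ} {r : Expo k}

/-- An element of `Θ` with finite first component. -/
def Theta.fin (j₀ j₁ : Expo k) : Theta p f r := ((j₀ : OnePoint (Expo k)), j₁)

/-- An element of `Θ` with first component `∞`. -/
def Theta.inf (j₁ : Expo k) : Theta p f r := (OnePoint.infty, j₁)

lemma Gen.le {i i' : Theta p f r} (h : Gen p f r i' i) : i' ≤ i := Relation.ReflTransGen.single h

variable [Finite k] [Fact p.Prime]

/-- If every step that splits off a power of `p` goes down, then so does every step
`n ↦ n - i` for which `n.choose i` is prime to `p`; the second argument of `g` keeps track of the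
total amount that was removed. -/
lemma le_of_steps {α : Type*} [Preorder α] (hk : Nat.card k = p ^ f) (g : Expo k → Expo k → α)
    (hg : ∀ (j a b : Expo k) (m : ℕ), m < f → Expo.IsDotSub p f a ((p ^ m : ℕ) : Expo k) b →
      g b (j + ((p ^ m : ℕ) : Expo k)) ≤ g a j) (i : ℕ) :
    ∀ (n : ℕ) (j : Expo k), n < p ^ f → i ≤ n → ¬ p ∣ n.choose i →
      g ((n - i : ℕ) : Expo k) (j + (i : Expo k)) ≤ g (n : Expo k) j := by
  induction i using Nat.strong_induction_on with
  | _ i ih =>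
    intro n j hn hi hc
    rcases eq_or_ne i 0 with rfl | hi0
    · rw [Nat.sub_zero, show j + ((0 : ℕ) : Expo k) = j from add_zero j]
    · obtain ⟨m, hm, hmi, hd, hc'⟩ := exists_isDotSub_prime_pow hk hn hi0 hi hc
      have hpos : 0 < p ^ m := pow_pos (Fact.out : p.Prime).pos m
      have h1 := ih (i - p ^ m) (by omega) (n - p ^ m) (j + ((p ^ m : ℕ) : Expo k)) (by omega)
        (by omega) hc'
      rw [show n - p ^ m - (i - p ^ m) = n - i by omega, add_assoc, ← Expo.coe_add,
        Nat.add_sub_cancel' hmi] at h1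
      exact h1.trans (hg j _ _ m hm hd)

variable (hk : Nat.card k = p ^ f) {n i : ℕ} (hn : n < p ^ f) (hi : i ≤ n)
  (hc : ¬ p ∣ n.choose i)
include hk hn hi hc

lemma fin_sub_le_fst (j₁ : Expo k) :
    (Theta.fin ((n - i : ℕ) : Expo k) j₁ : Theta p f r) ≤ Theta.fin (n : Expo k) j₁ :=
  le_of_steps hk (fun a _ => (Theta.fin a j₁ : Theta p f r))
    (fun _ _ _ m hm h => (Gen.lower_fst _ _ _ m hm h).le) i n 0 hn hi hc

lemma fin_sub_le_snd (j₀ : Expo k) :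
    (Theta.fin j₀ ((n - i : ℕ) : Expo k) : Theta p f r) ≤ Theta.fin j₀ (n : Expo k) :=
  le_of_steps hk (fun a _ => (Theta.fin j₀ a : Theta p f r))
    (fun _ _ _ m hm h => (Gen.lower_snd _ _ _ m hm h).le) i n 0 hn hi hc

lemma fin_add_sub_le (j₀ : Expo k) :
    (Theta.fin (j₀ + (i : Expo k)) ((n - i : ℕ) : Expo k) : Theta p f r) ≤
      Theta.fin j₀ (n : Expo k) :=
  le_of_steps hk (fun a j => (Theta.fin j a : Theta p f r))
    (fun _ _ _ m hm h => (Gen.shift _ _ _ m hm h).le) i n j₀ hn hi hc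

lemma fin_sub_le_inf_fst (hi0 : i ≠ 0) {j₁ : Expo k}
    (hs : Expo.IsSub r (2 • j₁) (n : Expo k)) :
    (Theta.fin ((n - i : ℕ) : Expo k) j₁ : Theta p f r) ≤ Theta.inf j₁ := by
  obtain ⟨m, hm, hmi, hd, hc'⟩ := exists_isDotSub_prime_pow hk hn hi0 hi hc
  have h1 := fin_sub_le_fst (r := r) hk (by omega) (by omega) hc' j₁
  rw [show n - p ^ m - (i - p ^ m) = n - i by omega] at h1
  exact h1.trans (Gen.infty_fst j₁ _ _ m hm hs hd).le

lemma fin_sub_le_inf_snd (hi0 : i ≠ 0) {s : Expo k}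
    (hs : Expo.IsSub r (2 • (n : Expo k)) s) :
    (Theta.fin s ((n - i : ℕ) : Expo k) : Theta p f r) ≤ Theta.inf (n : Expo k) := by
  obtain ⟨m, hm, hmi, hd, hc'⟩ := exists_isDotSub_prime_pow hk hn hi0 hi hc
  have h1 := fin_sub_le_snd (r := r) hk (by omega) (by omega) hc' s
  rw [show n - p ^ m - (i - p ^ m) = n - i by omega] at h1
  exact h1.trans (Gen.infty_snd _ s _ m hm hs hd).le

end Chains

/-! ### Submodules generated by the vectors `f_{(j₀, j₁)}` -/

section Submodules

variable {p : ℕ} [Fact p.Prime] {F : Type*} [Field F] [Algebra ℚ_[p] F]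
  [FiniteDimensional ℚ_[p] F] {E : Type*} [Field E] [Algebra (ResField p F) E]
  {ϖ : valRing p F} (hϖ : IsLocalRing.maximalIdeal (valRing p F) = Ideal.span {ϖ})
  {f : ℕ} (hf : Nat.card (ResField p F) = p ^ f) (hp0 : (p : O2 p F) = 0)
  {r : Expo (ResField p F)}

lemma basisVec_fin (j₀ j₁ : Expo (ResField p F)) :
    basisVec E hϖ f r (Theta.fin j₀ j₁) = basisFin E hϖ r j₀ j₁ := rfl

lemma basisVec_inf (j₁ : Expo (ResField p F)) :
    basisVec E hϖ f r (Theta.inf j₁) = PS E r weyl (basisFin E hϖ r 0 j₁) := rfl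

lemma weyl_weyl (v : PSSpace E r) : PS E r weyl (PS E r weyl v) = v := by
  rw [← Module.End.mul_apply, ← map_mul, weyl_mul_weyl, map_one, Module.End.one_apply]

include hp0 in
lemma choose_ne_zero_iff (n i : ℕ) :
    (n.choose i : ResField p F) ≠ 0 ↔ ¬ p ∣ n.choose i := by
  have h0 : (p : ResField p F) = 0 := by rw [← map_natCast (O2.red p F), hp0, map_zero]
  have : CharP (ResField p F) p := (CharP.charP_iff_prime_eq_zero Fact.out).2 h0
  rw [Ne, CharP.cast_eq_zero_iff (ResField p F) p]

include hf hp0 in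
/-- A `G₂`-submodule that contains `f_i` contains `f_{i'}` for every generating relation
`i' ≤_r i`. -/
lemma basisVec_mem_of_gen {W : Submodule E (PSSpace E r)}
    (hW : ∀ (g : Matrix.GeneralLinearGroup (Fin 2) (O2 p F)), ∀ v ∈ W, PS E r g v ∈ W)
    {i' i : Theta p f r} (h : Gen p f r i' i) (hi : basisVec E hϖ f r i ∈ W) :
    basisVec E hϖ f r i' ∈ W := by
  have hsub : ∀ g, ∀ v ∈ W, PS E r g v - v ∈ W := fun g v hv => W.sub_mem (hW g v hv) hv
  cases h with
  | lower_fst j₀ j₁ a m hm ha =>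
    obtain ⟨n, i, hn, hi0, hin, hc, rfl, -, rfl⟩ := ha.exists_nat hf
    refine mem_of_forall_binomSum_mem (hf ▸ hn)
      (v := fun i => basisFin E hϖ r (n - i : ℕ) j₁) (fun t => ?_) hi0 hin
      ((choose_ne_zero_iff hp0 n i).2 hc)
    rw [← upper_teichHom_basisFin hϖ hf hp0]
    exact hsub _ _ hi
  | lower_snd j₀ j₁ b m hm hb =>
    obtain ⟨n, i, hn, hi0, hin, hc, rfl, -, rfl⟩ := hb.exists_nat hf
    refine mem_of_forall_binomSum_mem (hf ▸ hn)
      (v := fun i => basisFin E hϖ r j₀ (n - i : ℕ)) (fun t => ?_) hi0 hin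
      ((choose_ne_zero_iff hp0 n i).2 hc)
    rw [← upper_teichHom_mul_basisFin hϖ hf hp0]
    exact hsub _ _ hi
  | shift j₀ j₁ b m hm hb =>
    obtain ⟨n, i, hn, hi0, hin, hc, rfl, hpi, rfl⟩ := hb.exists_nat hf
    rw [← hpi]
    refine mem_of_forall_binomSum_mem (hf ▸ hn)
      (v := fun i => basisFin E hϖ r (j₀ + (i : Expo (ResField p F))) (n - i : ℕ))
      (fun t => ?_) hi0 hin ((choose_ne_zero_iff hp0 n i).2 hc)
    -- The diagonal matrix with entries `1` and `u = 1 + [t] ϖ` substitutes `λ₁ + t λ₀` for `λ₁`.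
    have hu : IsUnit (1 + teichHom hf hp0 t * Ideal.Quotient.mk _ ϖ) := by
      rw [isUnit_iff_red_ne_zero, map_add, map_one, map_mul, red_mk_uniformizer hϖ, mul_zero,
        add_zero]
      exact one_ne_zero
    obtain ⟨u, hu⟩ := hu
    have hdu : digits hϖ ((1⁻¹ * u : (O2 p F)ˣ) : O2 p F) = (1, t) := by
      rw [inv_one, one_mul, hu, digits_add hϖ hf hp0, digits_one hϖ hf hp0,
        digits_teichHom_mul hϖ hf hp0, Prod.mk_add_mk, add_zero, zero_add]
    have h1 := torus_basisFin (E := E) hϖ hf hp0 r j₀ n 1 u hdu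
    rw [Units.val_one, map_one (O2.red p F), Expo.one_pow, Expo.one_pow, one_pow, one_mul, one_mul,
      map_one, one_smul, div_one] at h1
    rw [← sub_eq_iff_eq_add'.2 h1]
    exact hsub _ _ hi
  | reflect j₀ j₁ s a hj₀ hs ha =>
    refine (W.smul_mem_iff (algebraMap_sign_ne_zero (E := E) r j₁)).1 ?_
    change _ • basisFin E hϖ r a j₁ ∈ W
    rw [← weyl_basisFin hϖ hf hp0 hj₀ ha.2.1 (by rw [ha.2.2, hs.2.2])]
    exact hW _ _ hi
  | infty_snd j₁ s b m hm hs hb =>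
    obtain ⟨n, i, hn, hi0, hin, hc, rfl, -, rfl⟩ := hb.exists_nat hf
    refine mem_of_forall_binomSum_mem (hf ▸ hn)
      (v := fun i => basisFin E hϖ r s (n - i : ℕ)) (fun t => ?_) hi0 hin
      ((choose_ne_zero_iff hp0 n i).2 hc)
    rw [← upper_teichHom_mul_basisFin hϖ hf hp0]
    refine (W.smul_mem_iff (algebraMap_sign_ne_zero (E := E) r (n : Expo (ResField p F)))).1 ?_
    rw [← upper_weyl_basisFin hϖ hf hp0 hs]
    exact hsub _ _ hi
  | infty_fst j₁ s a m hm hs ha =>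
    obtain ⟨n, i, hn, hi0, hin, hc, rfl, -, rfl⟩ := ha.exists_nat hf
    refine mem_of_forall_binomSum_mem (hf ▸ hn)
      (v := fun i => basisFin E hϖ r (n - i : ℕ) j₁) (fun t => ?_) hi0 hin
      ((choose_ne_zero_iff hp0 n i).2 hc)
    rw [← upper_teichHom_basisFin hϖ hf hp0]
    refine (W.smul_mem_iff (algebraMap_sign_ne_zero (E := E) r j₁)).1 ?_
    rw [← upper_weyl_basisFin hϖ hf hp0 hs]
    exact hsub _ _ hi
  | zero_infty j₁ =>
    have h1 := hW weyl _ hi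
    rwa [show basisVec E hϖ f r (OnePoint.infty, j₁) = _ from basisVec_inf hϖ j₁, weyl_weyl] at h1
  | infty_zero j₁ => exact hW weyl _ hi

variable (E r) in
/-- The span of the `f_{i'}` with `i' ≤_r i`. -/
def lowerSpan (i : Theta p f r) : Submodule E (PSSpace E r) :=
  Submodule.span E (basisVec E hϖ f r '' {i' | i' ≤ i})

lemma typeSubspace_typeOf (i : Theta p f r) :
    typeSubspace E hϖ f r (typeOf i) = lowerSpan E hϖ r i := by
  rw [typeSubspace, lowerSpan]
  rfl

lemma basisVec_mem_lowerSpan {i' i : Theta p f r} (h : i' ≤ i) :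
    basisVec E hϖ f r i' ∈ lowerSpan E hϖ r i :=
  Submodule.subset_span ⟨i', h, rfl⟩

lemma lowerSpan_mono {i' i : Theta p f r} (h : i' ≤ i) :
    lowerSpan E hϖ r i' ≤ lowerSpan E hϖ r i :=
  Submodule.span_mono (Set.image_mono fun _ hj => le_trans hj h)

variable (E f r) in
/-- The elements `g` of `G₂` that map every `f_i` to a combination of the `f_{i'}` with
`i' ≤_r i`. -/
def triangular : Submonoid (Matrix.GeneralLinearGroup (Fin 2) (O2 p F)) where
  carrier := {g | ∀ i : Theta p f r, lowerSpan E hϖ r i ≤ (lowerSpan E hϖ r i).comap (PS E r g)}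
  one_mem' i := by
    rw [map_one]
    exact le_rfl
  mul_mem' {g h} hg hh i v hv := by
    rw [Submodule.mem_comap, map_mul]
    exact hg i (hh i hv)

lemma mem_triangular {g : Matrix.GeneralLinearGroup (Fin 2) (O2 p F)}
    (h : ∀ i : Theta p f r, PS E r g (basisVec E hϖ f r i) ∈ lowerSpan E hϖ r i) :
    g ∈ triangular E hϖ f r := by
  intro i
  refine Submodule.span_le.2 ?_
  rintro _ ⟨i', hi', rfl⟩
  exact lowerSpan_mono hϖ hi' (h i')

/-- Case distinction on an element of `Θ`. -/
lemma Theta.ind {P : Theta p f r → Prop} (h : ∀ j₀ j₁, P (Theta.fin j₀ j₁))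
    (h' : ∀ j₁, P (Theta.inf j₁)) (i : Theta p f r) : P i := by
  obtain ⟨j₀, j₁⟩ := i
  cases j₀ using OnePoint.rec with
  | infty => exact h' j₁
  | coe j₀ => exact h j₀ j₁

include hf hp0

lemma weyl_mem_triangular (hr : r ≠ 0) : weyl ∈ triangular E hϖ f r := by
  refine mem_triangular hϖ (Theta.ind (fun j₀ j₁ => ?_) fun j₁ => ?_)
  · rcases eq_or_ne j₀ 0 with rfl | hj₀
    -- `w f_{(0, j₁)}` is `f_{(∞, j₁)}` by definition.
    · exact basisVec_mem_lowerSpan hϖ (Gen.infty_zero j₁).le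
    · obtain ⟨s, hs⟩ := Expo.exists_isSub hr (2 • j₁)
      obtain ⟨a, ha⟩ := Expo.exists_isSub hs.2.1 j₀
      rw [basisVec_fin, weyl_basisFin hϖ hf hp0 hj₀ ha.2.1 (by rw [ha.2.2, hs.2.2])]
      exact Submodule.smul_mem _ _
        (basisVec_mem_lowerSpan hϖ (Gen.reflect j₀ j₁ s a hj₀ hs ha).le)
  · rw [basisVec_inf, weyl_weyl]
    exact basisVec_mem_lowerSpan hϖ (Gen.zero_infty j₁).le

lemma torus_mem_triangular (hr : r ≠ 0) (a b : (O2 p F)ˣ) :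
    torus a b ∈ triangular E hϖ f r := by
  have key : ∀ (a b : (O2 p F)ˣ) (j₀ j₁ : Expo (ResField p F)),
      PS E r (torus a b) (basisFin E hϖ r j₀ j₁) ∈
        lowerSpan E hϖ r (Theta.fin j₀ j₁ : Theta p f r) := by
    intro a b j₀ j₁
    obtain ⟨n, hn, rfl⟩ := Expo.exists_coe j₁
    rw [torus_basisFin hϖ hf hp0 r j₀ n a b rfl]
    refine Submodule.smul_mem _ _ (Submodule.add_mem _ (basisVec_mem_lowerSpan hϖ le_rfl)
      (binomSum_mem (fun i _ hi hc => ?_) _))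
    exact basisVec_mem_lowerSpan hϖ
      (fin_add_sub_le hf (hf ▸ hn) hi ((choose_ne_zero_iff hp0 n i).1 hc) j₀)
  refine mem_triangular hϖ (Theta.ind (fun j₀ j₁ => key a b j₀ j₁) fun j₁ => ?_)
  rw [basisVec_inf, ← Module.End.mul_apply, ← map_mul, torus_mul_weyl, map_mul]
  exact weyl_mem_triangular hϖ hf hp0 hr _
    (lowerSpan_mono hϖ (Gen.zero_infty j₁).le (key b a 0 j₁))

/-- For `f_{(∞, j₁)}`, the change made by the unipotent has no term for `i = 0`, so it involves only
vectors `f_{(r - 2 j₁ - i, j₁)}` with `i ≠ 0`. This matters because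
`(r - 2 j₁, j₁) ≤_r (∞, j₁)` need not hold. -/
lemma upper_teichHom_mem_triangular (hr : r ≠ 0) (t : ResField p F) :
    upper (-teichHom hf hp0 t) ∈ triangular E hϖ f r := by
  refine mem_triangular hϖ (Theta.ind (fun j₀ j₁ => ?_) fun j₁ => ?_)
  · obtain ⟨n, hn, rfl⟩ := Expo.exists_coe j₀
    refine (Submodule.sub_mem_iff_left _ (basisVec_mem_lowerSpan hϖ le_rfl)).1 ?_
    rw [basisVec_fin, upper_teichHom_basisFin hϖ hf hp0 r j₁ n t]
    refine binomSum_mem (fun i _ hi hc => ?_) _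
    exact basisVec_mem_lowerSpan hϖ
      (fin_sub_le_fst hf (hf ▸ hn) hi ((choose_ne_zero_iff hp0 n i).1 hc) j₁)
  · obtain ⟨s, hs⟩ := Expo.exists_isSub hr (2 • j₁)
    obtain ⟨n, hn, rfl⟩ := Expo.exists_coe s
    refine (Submodule.sub_mem_iff_left _ (basisVec_mem_lowerSpan hϖ le_rfl)).1 ?_
    rw [basisVec_inf, upper_weyl_basisFin hϖ hf hp0 hs, upper_teichHom_basisFin hϖ hf hp0 r j₁ n t]
    refine Submodule.smul_mem _ _ (binomSum_mem (fun i hi0 hi hc => ?_) _)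
    exact basisVec_mem_lowerSpan hϖ
      (fin_sub_le_inf_fst hf (hf ▸ hn) hi ((choose_ne_zero_iff hp0 n i).1 hc) hi0 hs)

lemma upper_teichHom_mul_mem_triangular (hr : r ≠ 0) (t : ResField p F) :
    upper (-(teichHom hf hp0 t * Ideal.Quotient.mk _ ϖ)) ∈ triangular E hϖ f r := by
  refine mem_triangular hϖ (Theta.ind (fun j₀ j₁ => ?_) fun j₁ => ?_)
  · obtain ⟨n, hn, rfl⟩ := Expo.exists_coe j₁
    refine (Submodule.sub_mem_iff_left _ (basisVec_mem_lowerSpan hϖ le_rfl)).1 ?_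
    rw [basisVec_fin, upper_teichHom_mul_basisFin hϖ hf hp0 r j₀ n t]
    refine binomSum_mem (fun i _ hi hc => ?_) _
    exact basisVec_mem_lowerSpan hϖ
      (fin_sub_le_snd hf (hf ▸ hn) hi ((choose_ne_zero_iff hp0 n i).1 hc) j₀)
  · obtain ⟨n, hn, rfl⟩ := Expo.exists_coe j₁
    obtain ⟨s, hs⟩ := Expo.exists_isSub hr (2 • (n : Expo (ResField p F)))
    refine (Submodule.sub_mem_iff_left _ (basisVec_mem_lowerSpan hϖ le_rfl)).1 ?_
    rw [basisVec_inf, upper_weyl_basisFin hϖ hf hp0 hs,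
      upper_teichHom_mul_basisFin hϖ hf hp0 r s n t]
    refine Submodule.smul_mem _ _ (binomSum_mem (fun i hi0 hi hc => ?_) _)
    exact basisVec_mem_lowerSpan hϖ
      (fin_sub_le_inf_snd hf (hf ▸ hn) hi ((choose_ne_zero_iff hp0 n i).1 hc) hi0 hs)

lemma triangular_eq_top (hr : r ≠ 0) : triangular E hϖ f r = ⊤ := by
  refine submonoid_eq_top_of_generators _ (weyl_mem_triangular hϖ hf hp0 hr) (fun t => ?_)
    (torus_mem_triangular hϖ hf hp0 hr)
  rw [← neg_neg t, eq_teichHom_add hϖ hf hp0 (-t), neg_add, upper_add]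
  exact mul_mem (upper_teichHom_mem_triangular hϖ hf hp0 hr _)
    (upper_teichHom_mul_mem_triangular hϖ hf hp0 hr _)

end Submodules

end GL2PS

end

theorem mainTheorem1 (p : ℕ) [Fact p.Prime]
    (F : Type*) [Field F] [Algebra ℚ_[p] F] [FiniteDimensional ℚ_[p] F]
    (f : ℕ) (hf : Nat.card (GL2PS.ResField p F) = p ^ f)
    (e : ℕ)
    (he : Ideal.span {(p : GL2PS.valRing p F)} =
      IsLocalRing.maximalIdeal (GL2PS.valRing p F) ^ e)
    (he2 : 2 ≤ e)
    (ϖ : GL2PS.valRing p F)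
    (hϖ : IsLocalRing.maximalIdeal (GL2PS.valRing p F) = Ideal.span {ϖ})
    (E : Type*) [Field E] [Algebra (GL2PS.ResField p F) E]
    (r : GL2PS.Expo (GL2PS.ResField p F)) (hr : r ≠ 0) :
    (∀ (θ : GL2PS.Types p f r) (g : Matrix.GeneralLinearGroup (Fin 2) (GL2PS.O2 p F)),
      ∀ v ∈ GL2PS.typeSubspace E hϖ f r θ,
        GL2PS.PS E r g v ∈ GL2PS.typeSubspace E hϖ f r θ) ∧
    (∀ i : GL2PS.Theta p f r,
      Submodule.span E (Set.range fun g : Matrix.GeneralLinearGroup (Fin 2) (GL2PS.O2 p F) =>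
          GL2PS.PS E r g (GL2PS.basisVec E hϖ f r i)) =
        GL2PS.typeSubspace E hϖ f r (GL2PS.typeOf i)) := by
  have hp0 := GL2PS.natCast_prime_eq_zero he he2
  have htop := GL2PS.triangular_eq_top (E := E) hϖ hf hp0 hr
  have hstable : ∀ (i : GL2PS.Theta p f r) g, ∀ v ∈ GL2PS.lowerSpan E hϖ r i,
      GL2PS.PS E r g v ∈ GL2PS.lowerSpan E hϖ r i := by
    intro i g v hv
    have hg : g ∈ GL2PS.triangular E hϖ f r := htop ▸ Submonoid.mem_top g
    exact hg i hv
  refine ⟨fun θ => ?_, fun i => ?_⟩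
  · obtain ⟨i, rfl⟩ : ∃ i, GL2PS.typeOf i = θ := Quotient.exists_rep θ
    rw [GL2PS.typeSubspace_typeOf]
    exact hstable i
  · rw [GL2PS.typeSubspace_typeOf]
    refine le_antisymm (Submodule.span_le.2 ?_) (Submodule.span_le.2 ?_)
    · rintro _ ⟨g, rfl⟩
      exact hstable i g _ (GL2PS.basisVec_mem_lowerSpan hϖ le_rfl)
    · set W := Submodule.span E (Set.range fun g => GL2PS.PS E r g (GL2PS.basisVec E hϖ f r i))
      have hW : ∀ g, ∀ v ∈ W, GL2PS.PS E r g v ∈ W := by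
        intro g
        refine Submodule.span_le (p := W.comap (GL2PS.PS E r g)) |>.2 ?_
        rintro _ ⟨h, rfl⟩
        refine Submodule.subset_span ⟨g * h, ?_⟩
        simp only [map_mul, Module.End.mul_apply]
      rintro _ ⟨i', hi', rfl⟩
      induction hi' using Relation.ReflTransGen.head_induction_on with
      | refl => exact Submodule.subset_span ⟨1, by simp only [map_one, Module.End.one_apply]⟩
      | head h _ ih => exact GL2PS.basisVec_mem_of_gen hϖ hf hp0 hW h ih
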